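/- For $\nu\in\mathbb R$ consider the planar system $$x' = x(\nu-x^2)+x^3y+xy^2,\qquad y'=-y+x^2y+x^4,\qquad\text{briefly } u'=F_\nu(u),$$ and for $\nu>0$ put $B_\nu=[-\sqrt{2\nu},\sqrt{2\nu}]\times[-\nu,\nu]$, $B_\nu^+=[\sqrt{\nu/2},\sqrt{2\nu}]\times[-\nu,\nu]$ and $B_\nu^-=[-\sqrt{2\nu},-\sqrt{\nu/2}]\times[-\nu,\nu]$. A full solution is a solution $u:\mathbb R\to\mathbb R^2$. The maximal invariant set in $S\subset\mathbb R^2$ is the largest $I\subset S$ such that a point $z\in S$ belongs to $I$ if and only if some full solution passes through $z$ and every full solution passing through $z$ stays in $I$. A fixed point $p$ is called hyperbolic if no eigenvalue of $DF_\nu(p)$ is purely imaginary or zero and, moreover, the strong cone conditions hold near $p$: there are a symmetric matrix $Q$, numbers $l,\delta>0$ and a neighbourhood $U$ of $p$ such that for all $z_1,z_2\in U$ and $|s|\le\delta$, with $\Delta=z_1-z_2$, $D=F_\nu(z_1)-F_\nu(z_2)$ and $Q_s=Q+s\,\mathrm{Id}$, one has $D^TQ_s\Delta+\Delta^TQ_sD\ge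 l\|\Delta\|^2$. A fixed point is called attracting if it is asymptotically stable. **Theorem.** There exist $\nu_-<0<\nu_+$ such that a pitchfork bifurcation occurs on $[\nu_-,\nu_+]$, with the isolating set $R=B_{\nu_+}$. That is: 1. There is $\varepsilon>0$ such that for every $\nu\in[\nu_-,\nu_+]$ each solution that starts in $R$ exists on $[0,\varepsilon]$ and lies in the interior of $R$ for $t\in(0,\varepsilon]$ (so $R$ is an $\varepsilon$-isolating cuboid without exit directions); in particular $R$ is forward-invariant. 2. The origin is a fixed point for all $\nu\in[\nu_-,\nu_+]$, and it is hyperbolic for $\nu\neq0$. 3. For $\nu\in[\nu_-,0]$ the set $\{0\}$ is the maximal invariant set in $R$. 4. For $\nu\in(0,\nu_+]$ there are two distinct hyperbolic attracting fixed points $u_\pm^\nu\in R$, different from the origin, with $u_+^\nu\in B_\nu^+$ and $u_-^\nu\in B_\nu^-$. There are heteroclinic connections $\gamma_\pm$ from the origin to $u_\pm^\nu$ (full solutions with $\gamma_\pm(t)\to0$ as $t\to-\infty$ and $\gamma_\pm(t)\to u_\pm^\nu$ as $t\to+\infty$), and $\{0,u_-^\nu,u_+^\nu\}\cup\gamma_-(\mathbb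 R)\cup\gamma_+(\mathbb R)$ is the maximal invariant set in $R$. -/

import Mathlib

open Set Filter Topology

/-! ### Autonomous equations `u' = F u` on `ℝ^ι`: solutions and invariant sets -/

section Dynamics

variable {E : Type*} [NormedAddCommGroup E] [NormedSpace ℝ E]

/-- `u` solves `u' = F u` on the set of times `s` (one-sided derivatives at end points). -/
def IsSolutionOn (F : E → E) (u : ℝ → E) (s : Set ℝ) : Prop :=
  IsIntegralCurveOn u (fun _ => F) s

/-- `u` is a full solution of `u' = F u`, i.e. a solution for all times `t ∈ ℝ`. -/
def IsFullSolution (F : E → E) (u : ℝ → E) : Prop :=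
  IsIntegralCurve u (fun _ => F)

/-- The defining property of an invariant subset `I` of `S`: a point `z` of `S` belongs to `I` if
and only if there is a full solution passing through `z` and every full solution passing
through `z` stays in `I` for all times. -/
def IsInvariantSubset (F : E → E) (S I : Set E) : Prop :=
  I ⊆ S ∧ ∀ z ∈ S, z ∈ I ↔
    (∃ u, IsFullSolution F u ∧ z ∈ range u) ∧
      ∀ u, IsFullSolution F u → z ∈ range u → ∀ t, u t ∈ I

/-- `I` is the maximal invariant set in `S`: the largest of the invariant subsets of `S`. -/
def IsMaximalInvariantSet (F : E → E) (S I : Set E) : Prop :=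
  IsGreatest {J | IsInvariantSubset F S J} I

/-- `S` is forward-invariant: through every point of `S` there is a solution for all `t ≥ 0`,
and solutions that start in `S` stay in `S`. -/
def IsForwardInvariantSet (F : E → E) (S : Set E) : Prop :=
  ∀ z ∈ S, (∃ u, IsSolutionOn F u (Ici 0) ∧ u 0 = z) ∧
    ∀ u, ∀ T, 0 ≤ T → IsSolutionOn F u (Icc 0 T) → u 0 = z → u T ∈ S

/-- `γ` is a heteroclinic connection from `p` to `q`. -/
def IsHeteroclinicConnection (F : E → E) (p q : E) (γ : ℝ → E) : Prop :=
  IsFullSolution F γ ∧ Tendsto γ atBot (𝓝 p) ∧ Tendsto γ atTop (𝓝 q)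

/-- `p` is an attracting (asymptotically stable) fixed point: it is Lyapunov stable, and the
solutions starting near `p` exist for all `t ≥ 0` and converge to `p`. -/
def IsAttractingFixedPoint (F : E → E) (p : E) : Prop :=
  F p = 0 ∧
  (∀ V ∈ 𝓝 p, ∃ U ∈ 𝓝 p, ∀ u, IsSolutionOn F u (Ici 0) → u 0 ∈ U → ∀ t, 0 ≤ t → u t ∈ V) ∧
  ∃ U ∈ 𝓝 p, ∀ z ∈ U, (∃ u, IsSolutionOn F u (Ici 0) ∧ u 0 = z) ∧
    ∀ u, IsSolutionOn F u (Ici 0) → u 0 = z → Tendsto u atTop (𝓝 p)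

end Dynamics

/-! ### Cuboids, cone conditions, hyperbolicity -/

section Bifurcation

variable {ι : Type*} [Fintype ι]

/-- The cuboid `∏ᵢ [a i, b i]` in `ℝ^ι`. -/
def cuboid (a b : ι → ℝ) : Set (EuclideanSpace ℝ ι) :=
  {z | ∀ i, z i ∈ Icc (a i) (b i)}

/-- The cuboid `S = ∏ᵢ [a i, b i]` is an `ε`-isolating cuboid for `u' = F u`, where the
coordinates in `exit` are the exit directions and the other ones the entry directions.
Solutions starting in `S` exist on `[0, ε]`. For `t ∈ (0, ε]` they are strictly between the two
faces in each entry direction, and those that start on a face of an exit direction are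
strictly beyond this face. -/
structure IsIsolatingCuboid (F : EuclideanSpace ℝ ι → EuclideanSpace ℝ ι) (exit : Set ι)
    (a b : ι → ℝ) (ε : ℝ) : Prop where
  eps_pos : 0 < ε
  nondegenerate : ∀ i, a i < b i
  exists_solution : ∀ z ∈ cuboid a b, ∃ u, IsSolutionOn F u (Icc 0 ε) ∧ u 0 = z
  entry_directions : ∀ u, IsSolutionOn F u (Icc 0 ε) → u 0 ∈ cuboid a b →
    ∀ i ∉ exit, ∀ t ∈ Ioc 0 ε, u t i ∈ Ioo (a i) (b i)
  exit_directions : ∀ u, IsSolutionOn F u (Icc 0 ε) → u 0 ∈ cuboid a b →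
    ∀ i ∈ exit, ∀ t ∈ Ioc 0 ε,
      (u 0 i = a i → u t i < a i) ∧ (u 0 i = b i → b i < u t i)

/-- The strong cone conditions on `U` for the quadratic form `z ↦ ⟨Q z, z⟩`, `Q` self-adjoint:
for `Q_s = Q + s Id` with `|s| ≤ δ`, the derivative at `t = 0` of `⟨Q_s d(t), d(t)⟩`, where
`d(t)` is the difference of the solutions starting at `z₁` and `z₂`, i.e. the number
`⟨Q_s (F z₁ - F z₂), z₁ - z₂⟩ + ⟨Q_s (z₁ - z₂), F z₁ - F z₂⟩`, is at least `l * ‖z₁ - z₂‖ ^ 2`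
for some `l > 0`. -/
def StrongConeConditions (F : EuclideanSpace ℝ ι → EuclideanSpace ℝ ι)
    (U : Set (EuclideanSpace ℝ ι)) (Q : EuclideanSpace ℝ ι →L[ℝ] EuclideanSpace ℝ ι) : Prop :=
  IsSelfAdjoint Q ∧ ∃ l : ℝ, 0 < l ∧ ∃ δ : ℝ, 0 < δ ∧
    ∀ z₁ ∈ U, ∀ z₂ ∈ U, ∀ s ∈ Icc (-δ) δ,
      l * ‖z₁ - z₂‖ ^ 2 ≤
        inner ℝ (Q (F z₁ - F z₂) + s • (F z₁ - F z₂)) (z₁ - z₂) +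
          inner ℝ (Q (z₁ - z₂) + s • (z₁ - z₂)) (F z₁ - F z₂)

/-- `p` is a hyperbolic fixed point, both in the sense of cones (the strong cone conditions hold
in a neighbourhood of `p` for some quadratic form) and in the standard sense for ODEs
(no eigenvalue of the derivative at `p` lies on the imaginary axis). -/
structure IsHyperbolicFixedPoint (F : EuclideanSpace ℝ ι → EuclideanSpace ℝ ι)
    (p : EuclideanSpace ℝ ι) : Prop where
  fixed : F p = 0
  cone : ∃ U ∈ 𝓝 p, ∃ Q, StrongConeConditions F U Q
  differentiable : DifferentiableAt ℝ F p
  eigenvalues : ∀ μ : ℂ,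
    ((fderiv ℝ F p).toLinearMap.charpoly.map (algebraMap ℝ ℂ)).IsRoot μ → μ.re ≠ 0

/-- The family `u' = F ν u` undergoes a pitchfork bifurcation on `[νm, νp]`, where
`R = cuboid a b` (with exit directions `exit`) is the set isolating all dynamics near the
bifurcation, `u₀` is the persistent fixed point and `um ν`, `up ν`, for `ν ∈ (0, νp]`, are the
fixed points which are born. -/
structure IsPitchforkBifurcation
    (F : ℝ → EuclideanSpace ℝ ι → EuclideanSpace ℝ ι) (νm νp : ℝ)
    (exit : Set ι) (a b : ι → ℝ)
    (u₀ : EuclideanSpace ℝ ι) (um up : ℝ → EuclideanSpace ℝ ι) : Prop where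
  neg : νm < 0
  pos : 0 < νp
  isolating : ∃ ε, ∀ ν ∈ Icc νm νp, IsIsolatingCuboid (F ν) exit a b ε
  mem : u₀ ∈ cuboid a b
  fixed : ∀ ν ∈ Icc νm νp, F ν u₀ = 0
  hyperbolic : ∀ ν ∈ Icc νm νp, ν ≠ 0 → IsHyperbolicFixedPoint (F ν) u₀
  before : ∀ ν ∈ Icc νm 0, IsMaximalInvariantSet (F ν) (cuboid a b) {u₀}
  born_mem : ∀ ν ∈ Ioc 0 νp, um ν ∈ cuboid a b ∧ up ν ∈ cuboid a b
  born_ne : ∀ ν ∈ Ioc 0 νp, um ν ≠ u₀ ∧ up ν ≠ u₀ ∧ um ν ≠ up ν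
  born_hyperbolic : ∀ ν ∈ Ioc 0 νp,
    IsHyperbolicFixedPoint (F ν) (um ν) ∧ IsHyperbolicFixedPoint (F ν) (up ν)
  after : ∀ ν ∈ Ioc 0 νp, ∃ γm γp : ℝ → EuclideanSpace ℝ ι,
    IsHeteroclinicConnection (F ν) u₀ (um ν) γm ∧
    IsHeteroclinicConnection (F ν) u₀ (up ν) γp ∧
    IsMaximalInvariantSet (F ν) (cuboid a b)
      ({u₀, um ν, up ν} ∪ range γm ∪ range γp)

end Bifurcation

/-! ### The planar model -/

/-- The right-hand side of `x' = x(ν - x²) + x³y + xy²`, `y' = -y + x²y + x⁴`. -/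
noncomputable def modelField (ν : ℝ) (z : EuclideanSpace ℝ (Fin 2)) : EuclideanSpace ℝ (Fin 2) :=
  !₂[z 0 * (ν - z 0 ^ 2) + z 0 ^ 3 * z 1 + z 0 * z 1 ^ 2,
     -z 1 + z 0 ^ 2 * z 1 + z 0 ^ 4]

/-- Lower corner of `B_ν = [-√(2ν), √(2ν)] × [-ν, ν]`. -/
noncomputable def boxLower (ν : ℝ) : Fin 2 → ℝ := ![-√(2 * ν), -ν]

/-- Upper corner of `B_ν = [-√(2ν), √(2ν)] × [-ν, ν]`. -/
noncomputable def boxUpper (ν : ℝ) : Fin 2 → ℝ := ![√(2 * ν), ν]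

/-- `B_ν⁺ = [√(ν/2), √(2ν)] × [-ν, ν]`, a neighbourhood of `(√ν, 0)`. -/
noncomputable def boxPlus (ν : ℝ) : Set (EuclideanSpace ℝ (Fin 2)) :=
  cuboid ![√(ν / 2), -ν] ![√(2 * ν), ν]

/-- `B_ν⁻ = [-√(2ν), -√(ν/2)] × [-ν, ν]`, a neighbourhood of `(-√ν, 0)`. -/
noncomputable def boxMinus (ν : ℝ) : Set (EuclideanSpace ℝ (Fin 2)) :=
  cuboid ![-√(2 * ν), -ν] ![-√(ν / 2), ν]

open scoped NNReal

/-! ### Uniqueness, full orbits in a set, and global solutions of autonomous equations -/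

section ODE

variable {E : Type*} [NormedAddCommGroup E] [NormedSpace ℝ E] {F : E → E} {u v : ℝ → E} {a b : ℝ}

/-! The parameters are `νm = -1/100` and `νp = 1/100`. The field points strictly inwards on the
boundary of the resulting box, which gives isolation and forward invariance. By uniqueness of
solutions the maximal invariant set is the set of points whose full orbit stays in the box
(`isMaximalInvariantSet_fullOrbitsIn`), so the task is to find all such orbits.

Cones reduce this to one dimension. For the difference of two solutions in the box, the form Δy² -
Δx²/4 satisfies V' ≤ -V (`coneForm_deriv_le`). Two full solutions in the box have V bounded in the
past, hence V ≤ 0: together these orbits lie on the graph of a 1/2-Lipschitz function of x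
(`abs_sub_le_of_isFullSolution`). Moreover x' = x g with a bounded rate g, so the sign of x is
preserved, and along the cones g decreases in x > 0 (`growthRate_sub_le`).

For ν ≤ 0 the rate is at most -x²/2, so any orbit with x ≠ 0 would grow exponentially backwards and
leave the box (`eq_zero_of_nonpos_param`). For ν > 0 the intermediate value theorem gives a fixed
point P with positive first coordinate. To its right g is negative and the same backward escape
excludes orbits; between 0 and P the rate is positive, and every orbit there is a heteroclinic
connection (`isHeteroclinicConnection_of_fst_lt`). One exists as a limit of solutions starting ever
closer to the origin (`exists_isFullSolution_fst_lt`), and the cones make it unique up to a time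
shift. The reflection x ↦ -x settles the left half.

Hyperbolicity follows from a definite quadratic form for the linearization, attraction from negative
definiteness of its symmetric part at the new fixed points. -/

theorem IsSolutionOn.hasDerivWithinAt_Ici (hu : IsSolutionOn F u (Icc a b)) {t : ℝ}
    (ht : t ∈ Ico a b) : HasDerivWithinAt u (F (u t)) (Ici t) t :=
  (hu t (Ico_subset_Icc_self ht)).mono_of_mem_nhdsWithin (Icc_mem_nhdsGE_of_mem ht)

theorem IsSolutionOn.hasDerivWithinAt_Iic (hu : IsSolutionOn F u (Icc a b)) {t : ℝ}
    (ht : t ∈ Ioc a b) : HasDerivWithinAt u (F (u t)) (Iic t) t :=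
  (hu t (Ioc_subset_Icc_self ht)).mono_of_mem_nhdsWithin (Icc_mem_nhdsLE_of_mem ht)

theorem IsSolutionOn.continuousOn {s : Set ℝ} (hu : IsSolutionOn F u s) : ContinuousOn u s :=
  IsIntegralCurveOn.continuousOn hu

theorem IsSolutionOn.mono {s t : Set ℝ} (hu : IsSolutionOn F u s) (h : t ⊆ s) :
    IsSolutionOn F u t :=
  IsIntegralCurveOn.mono hu h

theorem IsFullSolution.isSolutionOn (hu : IsFullSolution F u) (s : Set ℝ) : IsSolutionOn F u s :=
  IsIntegralCurve.isIntegralCurveOn hu s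

theorem IsFullSolution.comp_add (hu : IsFullSolution F u) (c : ℝ) :
    IsFullSolution F (fun t => u (t + c)) :=
  IsIntegralCurve.comp_add hu c

theorem LocallyLipschitz.exists_lipschitzOnWith_image_union {E : Type*} [NormedAddCommGroup E]
    {F : E → E} {u v : ℝ → E} {a b : ℝ} (hF : LocallyLipschitz F)
    (hu : ContinuousOn u (Icc a b)) (hv : ContinuousOn v (Icc a b)) :
    ∃ K, LipschitzOnWith K F (u '' Icc a b ∪ v '' Icc a b) :=
  LocallyLipschitzOn.exists_lipschitzOnWith_of_compact
    ((isCompact_Icc.image_of_continuousOn hu).union (isCompact_Icc.image_of_continuousOn hv))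
    (hF.locallyLipschitzOn)

theorem IsSolutionOn.eqOn_of_left (hF : LocallyLipschitz F) (hu : IsSolutionOn F u (Icc a b))
    (hv : IsSolutionOn F v (Icc a b)) (h : u a = v a) : EqOn u v (Icc a b) := by
  obtain ⟨K, hK⟩ := hF.exists_lipschitzOnWith_image_union hu.continuousOn hv.continuousOn
  exact ODE_solution_unique_of_mem_Icc_right (v := fun _ => F) (fun _ _ => hK)
    hu.continuousOn (fun t ht => hu.hasDerivWithinAt_Ici ht)
    (fun t ht => Or.inl (mem_image_of_mem _ (Ico_subset_Icc_self ht)))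
    hv.continuousOn (fun t ht => hv.hasDerivWithinAt_Ici ht)
    (fun t ht => Or.inr (mem_image_of_mem _ (Ico_subset_Icc_self ht))) h

theorem IsSolutionOn.eqOn_of_right (hF : LocallyLipschitz F) (hu : IsSolutionOn F u (Icc a b))
    (hv : IsSolutionOn F v (Icc a b)) (h : u b = v b) : EqOn u v (Icc a b) := by
  obtain ⟨K, hK⟩ := hF.exists_lipschitzOnWith_image_union hu.continuousOn hv.continuousOn
  exact ODE_solution_unique_of_mem_Icc_left (v := fun _ => F) (fun _ _ => hK)
    hu.continuousOn (fun t ht => hu.hasDerivWithinAt_Iic ht)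
    (fun t ht => Or.inl (mem_image_of_mem _ (Ioc_subset_Icc_self ht)))
    hv.continuousOn (fun t ht => hv.hasDerivWithinAt_Iic ht)
    (fun t ht => Or.inr (mem_image_of_mem _ (Ioc_subset_Icc_self ht))) h

theorem IsFullSolution.eq_of_apply_eq (hF : LocallyLipschitz F) (hu : IsFullSolution F u)
    (hv : IsFullSolution F v) {t₀ : ℝ} (h : u t₀ = v t₀) : u = v := by
  ext t
  rcases le_total t t₀ with ht | ht
  · exact (hu.isSolutionOn (Icc t t₀)).eqOn_of_right hF (hv.isSolutionOn _) h ⟨le_rfl, ht⟩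
  · exact (hu.isSolutionOn (Icc t₀ t)).eqOn_of_left hF (hv.isSolutionOn _) h ⟨ht, le_rfl⟩

/-- The points through which there passes a full solution that stays in `S`. -/
def fullOrbitsIn (F : E → E) (S : Set E) : Set E :=
  {z | ∃ u, IsFullSolution F u ∧ u 0 = z ∧ ∀ t, u t ∈ S}

theorem apply_mem_fullOrbitsIn {S : Set E} (hu : IsFullSolution F u) (hS : ∀ t, u t ∈ S) (t : ℝ) :
    u t ∈ fullOrbitsIn F S :=
  ⟨fun s => u (s + t), hu.comp_add t, by simp, fun s => hS _⟩

/-- Uniqueness makes all full solutions through a point time shifts of one another, so a single one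
staying in `S` controls all of them. Conversely, every invariant subset is made up of such orbits.
-/
theorem isMaximalInvariantSet_fullOrbitsIn (hF : LocallyLipschitz F) (S : Set E) :
    IsMaximalInvariantSet F S (fullOrbitsIn F S) := by
  refine ⟨⟨?_, fun z hz => ⟨?_, ?_⟩⟩, ?_⟩
  · rintro z ⟨u, -, rfl, h⟩
    exact h 0
  · rintro ⟨u, hu, rfl, h⟩
    refine ⟨⟨u, hu, 0, rfl⟩, fun w hw ⟨c, hc⟩ t => ?_⟩
    have : (fun t => w (t + c)) = u :=
      (hw.comp_add c).eq_of_apply_eq hF hu (t₀ := 0) (by simpa using hc)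
    have h2 : w t = u (t - c) := by rw [← this]; simp
    rw [h2]
    exact apply_mem_fullOrbitsIn hu h _
  · rintro ⟨⟨u, hu, t, rfl⟩, h⟩
    exact h u hu ⟨t, rfl⟩ t
  · rintro J ⟨hJS, hJ⟩ z hz
    obtain ⟨⟨u, hu, c, rfl⟩, h⟩ := (hJ z (hJS hz)).1 hz
    exact ⟨fun s => u (s + c), hu.comp_add c, by simp, fun s => hJS (h u hu ⟨c, rfl⟩ _)⟩

theorem exists_isFullSolution_of_lipschitzWith_of_bounded [CompleteSpace E] {K : ℝ≥0}
    (hF : LipschitzWith K F) {L : ℝ≥0} (hL : ∀ z, ‖F z‖ ≤ L) (z : E) :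
    ∃ u, IsFullSolution F u ∧ u 0 = z := by
  have key : ∀ n : ℕ, ∃ α : ℝ → E, α 0 = z ∧ IsSolutionOn F α (Icc (-(n : ℝ)) n) := by
    intro n
    have h0 : (0 : ℝ) ∈ Icc (-(n : ℝ)) n := by simp
    -- The bound `L` on the field keeps solutions within distance `L * n` during time `n`, so one
    -- application of Picard–Lindelöf covers the whole interval.
    have hP : IsPicardLindelof (fun _ : ℝ => F) (⟨0, h0⟩ : Icc (-(n : ℝ)) n) z (L * n) 0 L K :=
      IsPicardLindelof.of_time_independent (fun x _ => hL x) hF.lipschitzOnWith (by simp)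
    exact hP.exists_eq_forall_mem_Icc_hasDerivWithinAt₀
  choose α hα0 hα using key
  have hmono : ∀ {m n : ℕ}, m ≤ n → EqOn (α m) (α n) (Icc (-(m : ℝ)) m) := by
    intro m n hmn t ht
    have hmn' : (m : ℝ) ≤ n := by exact_mod_cast hmn
    have h0 : (0 : ℝ) ≤ m := by positivity
    have hlip := hF.locallyLipschitz
    have hn : IsSolutionOn F (α n) (Icc (-(m : ℝ)) m) :=
      (hα n).mono (Icc_subset_Icc (by linarith) hmn')
    rcases le_total t 0 with h | h
    · exact ((hα m).mono (Icc_subset_Icc le_rfl h0)).eqOn_of_right hlip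
        (hn.mono (Icc_subset_Icc le_rfl h0)) (by rw [hα0, hα0]) ⟨ht.1, h⟩
    · exact ((hα m).mono (Icc_subset_Icc (by linarith) le_rfl)).eqOn_of_left hlip
        (hn.mono (Icc_subset_Icc (by linarith) le_rfl)) (by rw [hα0, hα0]) ⟨h, ht.2⟩
  -- The local solutions agree on overlaps, so they are glued by using at time `t` any interval that
  -- contains `t`.
  refine ⟨fun t => α ⌈|t|⌉₊ t, fun t => ?_, by simp [hα0]⟩
  have habs : ∀ (s : ℝ) (n : ℕ), |s| ≤ n → α ⌈|s|⌉₊ s = α n s := fun s n hs =>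
    hmono (Nat.ceil_le.2 hs) (abs_le.1 (Nat.le_ceil _))
  obtain ⟨n, hn⟩ := exists_nat_gt |t|
  have hev : ∀ᶠ s : ℝ in 𝓝 t, |s| < (n : ℝ) := continuous_abs.continuousAt.eventually_lt
    continuousAt_const hn
  have hIcc : Icc (-(n : ℝ)) n ∈ 𝓝 t := by
    filter_upwards [hev] with s hs using abs_le.1 hs.le
  have hd := ((hα n) t (abs_le.1 hn.le)).hasDerivAt hIcc
  have := hd.congr_of_eventuallyEq (f₁ := fun t => α ⌈|t|⌉₊ t)
    (by filter_upwards [hev] with s hs using habs s n hs.le)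
  simpa only [habs t n hn.le] using this

theorem IsFullSolution.dist_le_mul_exp_abs {K : ℝ≥0} (hF : LipschitzWith K F)
    (hu : IsFullSolution F u) (hv : IsFullSolution F v) (t : ℝ) :
    dist (u t) (v t) ≤ dist (u 0) (v 0) * Real.exp (K * |t|) := by
  have key : ∀ {G : E → E} {u v : ℝ → E}, LipschitzWith K G → IsFullSolution G u →
      IsFullSolution G v → ∀ t, 0 ≤ t →
      dist (u t) (v t) ≤ dist (u 0) (v 0) * Real.exp (K * t) := by
    intro G u v hG hu hv t ht
    have := dist_le_of_trajectories_ODE (v := fun _ => G) (fun _ => hG) (a := 0) (b := t)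
      (hu.isSolutionOn _).continuousOn (fun s _ => (hu s).hasDerivWithinAt)
      (hv.isSolutionOn _).continuousOn (fun s _ => (hv s).hasDerivWithinAt) le_rfl t ⟨ht, le_rfl⟩
    simpa using this
  rcases le_total 0 t with ht | ht
  · simpa [abs_of_nonneg ht] using key hF hu hv t ht
  · have hrev : ∀ {w : ℝ → E}, IsFullSolution F w → IsFullSolution (-F) (fun t => w (-t)) := by
      intro w hw t
      have := (hw (-t)).scomp t (hasDerivAt_neg t)
      simpa [Function.comp_def] using this
    have := key (G := -F) hF.neg (hrev hu) (hrev hv) (-t) (by linarith)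
    simpa [abs_of_nonpos ht] using this

end ODE

/-! ### Differential inequalities -/

/-- The function f(t) exp(k(t - a)) has nonpositive derivative. No sign of `f` or `k` is needed,
which allows use with indefinite forms and with -x². -/
theorem le_mul_exp_of_hasDerivWithinAt_le {f f' : ℝ → ℝ} {a b k : ℝ} (hab : a ≤ b)
    (hf : ∀ t ∈ Icc a b, HasDerivWithinAt f (f' t) (Icc a b) t)
    (h : ∀ t ∈ Icc a b, f' t ≤ -k * f t) : f b ≤ f a * Real.exp (-k * (b - a)) := by
  have he : ∀ t : ℝ, HasDerivAt (fun t => Real.exp (k * (t - a))) (Real.exp (k * (t - a)) * k) t := by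
    intro t
    simpa using (((hasDerivAt_id t).sub_const a).const_mul k).exp
  have hg : ∀ t ∈ Icc a b, HasDerivWithinAt (fun t => f t * Real.exp (k * (t - a)))
      (f' t * Real.exp (k * (t - a)) + f t * (Real.exp (k * (t - a)) * k)) (Icc a b) t :=
    fun t ht => (hf t ht).mul (he t).hasDerivWithinAt
  have := image_le_of_deriv_right_le_deriv_boundary (B := fun _ => f a) (B' := fun _ => 0)
    (fun t ht => (hg t ht).continuousWithinAt)
    (fun t ht => (hg t (Ico_subset_Icc_self ht)).mono_of_mem_nhdsWithin (Icc_mem_nhdsGE_of_mem ht))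
    (by simp) continuousOn_const (fun t _ => hasDerivWithinAt_const _ _ _)
    (fun t ht => by
      have := h t (Ico_subset_Icc_self ht)
      have hp := Real.exp_pos (k * (t - a))
      nlinarith) ⟨hab, le_rfl⟩
  rw [neg_mul, Real.exp_neg, ← div_eq_mul_inv, le_div_iff₀ (Real.exp_pos _)]
  exact this

/-- A barrier argument gives the weak inequality. A later contact with the level `c` would be
approached from below, making the left slopes nonnegative, against the negative derivative there. -/
theorem lt_of_hasDerivWithinAt_neg_of_boundary {f f' : ℝ → ℝ} {a b c : ℝ}
    (hf : ∀ t ∈ Icc a b, HasDerivWithinAt f (f' t) (Icc a b) t) (ha : f a ≤ c)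
    (h : ∀ t ∈ Icc a b, f t = c → f' t < 0) : ∀ t ∈ Ioc a b, f t < c := by
  have hle : ∀ t ∈ Icc a b, f t ≤ c := fun t ht =>
    image_le_of_deriv_right_lt_deriv_boundary (B := fun _ => c) (B' := fun _ => 0)
      (fun t ht => (hf t ht).continuousWithinAt)
      (fun t ht => (hf t (Ico_subset_Icc_self ht)).mono_of_mem_nhdsWithin
        (Icc_mem_nhdsGE_of_mem ht))
      ha (fun t => hasDerivAt_const _ _) (fun t ht => h t (Ico_subset_Icc_self ht)) ht
  intro t ht
  refine lt_of_le_of_ne (hle t (Ioc_subset_Icc_self ht)) fun heq => ?_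
  have hneg := h t (Ioc_subset_Icc_self ht) heq
  have hd : HasDerivWithinAt f (f' t) (Iio t) t :=
    ((hf t (Ioc_subset_Icc_self ht)).mono_of_mem_nhdsWithin
      (Icc_mem_nhdsLE_of_mem ht)).mono Iio_subset_Iic_self
  have hs := hasDerivWithinAt_iff_tendsto_slope.1 hd
  simp only [Set.sdiff_singleton_eq_self self_notMem_Iio] at hs
  obtain ⟨s, hs1, hs2, hs3⟩ := ((hs.eventually_lt_const hneg).and
    ((Ioo_mem_nhdsLT ht.1 : Ioo a t ∈ 𝓝[<] t))).exists
  rw [slope_def_field, heq] at hs1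
  have : f s ≤ c := hle s ⟨hs2.le, hs3.le.trans ht.2⟩
  have h3 : 0 ≤ (c - f s) / (t - s) := div_nonneg (by linarith) (by linarith)
  have h4 : (f s - c) / (s - t) = (c - f s) / (t - s) := by
    rw [← neg_sub c, ← neg_sub t, neg_div_neg_eq]
  linarith

/-! ### Cuboids with strictly inward pointing boundary -/

section Cuboid

variable {ι : Type*} {a b : ι → ℝ}

theorem isClosed_cuboid (a b : ι → ℝ) : IsClosed (cuboid a b) := by
  have : cuboid a b = ⋂ i, (fun z : EuclideanSpace ℝ ι => z i) ⁻¹' Icc (a i) (b i) := by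
    ext z
    simp [cuboid]
  rw [this]
  exact isClosed_iInter fun i => isClosed_Icc.preimage (by fun_prop)

theorem isCompact_cuboid (a b : ι → ℝ) : IsCompact (cuboid a b) := by
  have : cuboid a b = (WithLp.toLp 2) '' (Set.pi univ fun i => Icc (a i) (b i)) := by
    ext z
    constructor
    · exact fun h => ⟨fun i => z i, fun i _ => h i, rfl⟩
    · rintro ⟨w, hw, rfl⟩ i
      exact hw i (mem_univ i)
  rw [this]
  exact (isCompact_univ_pi fun i => isCompact_Icc).image (PiLp.continuous_toLp 2 _)

/-- The coordinatewise projection of `ℝ^ι` onto the cuboid `∏ᵢ [a i, b i]`. -/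
noncomputable def clampToCuboid (a b : ι → ℝ) (z : EuclideanSpace ℝ ι) : EuclideanSpace ℝ ι :=
  WithLp.toLp 2 fun i => max (a i) (min (b i) (z i))

theorem clampToCuboid_mem (hab : ∀ i, a i ≤ b i) (z : EuclideanSpace ℝ ι) :
    clampToCuboid a b z ∈ cuboid a b :=
  fun i => ⟨le_max_left _ _, max_le (hab i) (min_le_left _ _)⟩

theorem clampToCuboid_of_mem {z : EuclideanSpace ℝ ι} (hz : z ∈ cuboid a b) :
    clampToCuboid a b z = z := by
  ext i
  simp [clampToCuboid, (hz i).1, (hz i).2]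

variable [Fintype ι] {F : EuclideanSpace ℝ ι → EuclideanSpace ℝ ι} {u : ℝ → EuclideanSpace ℝ ι}

theorem hasDerivWithinAt_coord {u : ℝ → EuclideanSpace ℝ ι} {u' : EuclideanSpace ℝ ι} {s : Set ℝ}
    {t : ℝ} (h : HasDerivWithinAt u u' s t) (i : ι) :
    HasDerivWithinAt (fun t => u t i) (u' i) s t :=
  (EuclideanSpace.proj i : EuclideanSpace ℝ ι →L[ℝ] ℝ).hasFDerivAt.comp_hasDerivWithinAt t h

theorem lipschitzWith_clampToCuboid (a b : ι → ℝ) : LipschitzWith 1 (clampToCuboid a b) := by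
  refine LipschitzWith.of_dist_le_mul fun z w => ?_
  rw [NNReal.coe_one, one_mul, EuclideanSpace.dist_eq, EuclideanSpace.dist_eq]
  refine Real.sqrt_le_sqrt (Finset.sum_le_sum fun i _ => ?_)
  have h : dist (clampToCuboid a b z i) (clampToCuboid a b w i) ≤ dist (z i) (w i) := by
    have h1 : LipschitzWith 1 fun x : ℝ => max (a i) (min (b i) x) :=
      (LipschitzWith.id.const_min _).const_max _
    simpa [clampToCuboid] using h1.dist_le_mul (z i) (w i)
  gcongr

/-- The vector field `F` points strictly inwards on every face of the cuboid `∏ᵢ [a i, b i]`. -/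
structure IsStrictlyInward (F : EuclideanSpace ℝ ι → EuclideanSpace ℝ ι) (a b : ι → ℝ) : Prop where
  locallyLipschitz : LocallyLipschitz F
  lt : ∀ i, a i < b i
  upper : ∀ z ∈ cuboid a b, ∀ i, z i = b i → F z i < 0
  lower : ∀ z ∈ cuboid a b, ∀ i, z i = a i → 0 < F z i

namespace IsStrictlyInward

/-- Composing with the projection onto the compact cuboid makes a locally Lipschitz field globally
Lipschitz and bounded, without changing it on the cuboid; hence global solutions become available.
-/
theorem exists_lipschitzWith_comp_clamp (h : IsStrictlyInward F a b) :
    ∃ K : ℝ≥0, LipschitzWith K (F ∘ clampToCuboid a b) := by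
  obtain ⟨K, hK⟩ := LocallyLipschitzOn.exists_lipschitzOnWith_of_compact (isCompact_cuboid a b)
    (h.locallyLipschitz.locallyLipschitzOn)
  refine ⟨K * 1, lipschitzOnWith_univ.1 (hK.comp
    (lipschitzWith_clampToCuboid a b).lipschitzOnWith fun z _ => ?_)⟩
  exact clampToCuboid_mem (fun i => (h.lt i).le) z

theorem exists_isFullSolution_comp_clamp (h : IsStrictlyInward F a b) (z : EuclideanSpace ℝ ι) :
    ∃ u, IsFullSolution (F ∘ clampToCuboid a b) u ∧ u 0 = z := by
  obtain ⟨K, hK⟩ := h.exists_lipschitzWith_comp_clamp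
  obtain ⟨C, hC⟩ := (isCompact_cuboid a b).exists_bound_of_continuousOn
    h.locallyLipschitz.continuous.continuousOn
  refine exists_isFullSolution_of_lipschitzWith_of_bounded hK (L := C.toNNReal) (fun w => ?_) z
  exact (hC _ (clampToCuboid_mem (fun i => (h.lt i).le) w)).trans (Real.le_coe_toNNReal C)

/-- Each coordinate can be treated alone: once it equals a face value, the clamped point lies on
that face, wherever the other coordinates are, and the field is inward there. -/
theorem mem_Ioo_of_comp_clamp (h : IsStrictlyInward F a b) {s T : ℝ}
    (hu : IsSolutionOn (F ∘ clampToCuboid a b) u (Icc s T)) (h0 : u s ∈ cuboid a b) (i : ι) :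
    ∀ t ∈ Ioc s T, u t i ∈ Ioo (a i) (b i) := by
  have hd := fun t ht => hasDerivWithinAt_coord (hu t ht) i
  have hab := fun i => (h.lt i).le
  intro t ht
  constructor
  · have := lt_of_hasDerivWithinAt_neg_of_boundary (c := -a i) (fun t ht => (hd t ht).neg)
      (neg_le_neg (h0 i).1) (fun t ht hte => ?_) t ht
    · simpa using this
    · have hte' : u t i = a i := by simpa using hte
      refine neg_neg_of_pos (h.lower _ (clampToCuboid_mem hab _) i ?_)
      simp [clampToCuboid, hte', hab i]
  · refine lt_of_hasDerivWithinAt_neg_of_boundary hd (h0 i).2 (fun t ht hte => ?_) t ht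
    refine h.upper _ (clampToCuboid_mem hab _) i ?_
    simp [clampToCuboid, hte, hab i]

theorem mem_of_comp_clamp (h : IsStrictlyInward F a b) {s T : ℝ}
    (hu : IsSolutionOn (F ∘ clampToCuboid a b) u (Icc s T)) (h0 : u s ∈ cuboid a b) :
    ∀ t ∈ Icc s T, u t ∈ cuboid a b := by
  intro t ht i
  rcases ht.1.eq_or_lt with rfl | hlt
  · exact h0 i
  · exact Ioo_subset_Icc_self (h.mem_Ioo_of_comp_clamp hu h0 i t ⟨hlt, ht.2⟩)

end IsStrictlyInward

theorem IsSolutionOn.of_comp_clamp {s : Set ℝ}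
    (hu : IsSolutionOn (F ∘ clampToCuboid a b) u s) (hs : ∀ t ∈ s, u t ∈ cuboid a b) :
    IsSolutionOn F u s := by
  intro t ht
  have := hu t ht
  simp only [Function.comp_apply, clampToCuboid_of_mem (hs t ht)] at this
  exact this

theorem IsSolutionOn.comp_clamp {s : Set ℝ}
    (hu : IsSolutionOn F u s) (hs : ∀ t ∈ s, u t ∈ cuboid a b) :
    IsSolutionOn (F ∘ clampToCuboid a b) u s := by
  intro t ht
  simp only [Function.comp_apply, clampToCuboid_of_mem (hs t ht)]
  exact hu t ht

namespace IsStrictlyInward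

theorem exists_isSolutionOn_Ici (h : IsStrictlyInward F a b) {z : EuclideanSpace ℝ ι}
    (hz : z ∈ cuboid a b) :
    ∃ u, IsSolutionOn F u (Ici 0) ∧ u 0 = z ∧ ∀ t, 0 ≤ t → u t ∈ cuboid a b := by
  obtain ⟨u, hu, rfl⟩ := h.exists_isFullSolution_comp_clamp z
  have hmem : ∀ t, 0 ≤ t → u t ∈ cuboid a b := fun t ht =>
    h.mem_of_comp_clamp (hu.isSolutionOn (Icc 0 t)) hz t ⟨ht, le_rfl⟩
  exact ⟨u, (hu.isSolutionOn (Ici 0)).of_comp_clamp hmem, rfl, hmem⟩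

/-- By uniqueness, an arbitrary solution coincides with the one already constructed inside the
cuboid, so facts about the clamped field carry over to `F`. -/
theorem isSolutionOn_comp_clamp (h : IsStrictlyInward F a b) {T : ℝ}
    (hu : IsSolutionOn F u (Icc 0 T)) (h0 : u 0 ∈ cuboid a b) :
    IsSolutionOn (F ∘ clampToCuboid a b) u (Icc 0 T) := by
  obtain ⟨w, hw, hw0, hmem⟩ := h.exists_isSolutionOn_Ici h0
  have heq := hu.eqOn_of_left h.locallyLipschitz (hw.mono Icc_subset_Ici_self) hw0.symm
  exact hu.comp_clamp fun t ht => by rw [heq ht]; exact hmem t ht.1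

theorem mem_Ioo (h : IsStrictlyInward F a b) {T : ℝ}
    (hu : IsSolutionOn F u (Icc 0 T)) (h0 : u 0 ∈ cuboid a b) (i : ι) :
    ∀ t ∈ Ioc 0 T, u t i ∈ Ioo (a i) (b i) :=
  h.mem_Ioo_of_comp_clamp (h.isSolutionOn_comp_clamp hu h0) h0 i

theorem mem_cuboid (h : IsStrictlyInward F a b) {T : ℝ}
    (hu : IsSolutionOn F u (Icc 0 T)) (h0 : u 0 ∈ cuboid a b) :
    ∀ t ∈ Icc 0 T, u t ∈ cuboid a b :=
  h.mem_of_comp_clamp (h.isSolutionOn_comp_clamp hu h0) h0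

theorem isIsolatingCuboid (h : IsStrictlyInward F a b) {ε : ℝ} (hε : 0 < ε) :
    IsIsolatingCuboid F ∅ a b ε where
  eps_pos := hε
  nondegenerate := h.lt
  exists_solution z hz := by
    obtain ⟨u, hu, hu0, -⟩ := h.exists_isSolutionOn_Ici hz
    exact ⟨u, hu.mono Icc_subset_Ici_self, hu0⟩
  entry_directions u hu h0 i _ := h.mem_Ioo hu h0 i
  exit_directions u _ _ i hi := absurd hi (notMem_empty i)

theorem isForwardInvariantSet (h : IsStrictlyInward F a b) :
    IsForwardInvariantSet F (cuboid a b) := by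
  intro z hz
  refine ⟨?_, ?_⟩
  · obtain ⟨u, hu, hu0, -⟩ := h.exists_isSolutionOn_Ici hz
    exact ⟨u, hu, hu0⟩
  · rintro u T hT hu rfl
    exact h.mem_cuboid hu hz T ⟨hT, le_rfl⟩

/-- A limit of solutions that have been in the cuboid for longer and longer times is a full
solution in the cuboid. -/
theorem exists_isFullSolution_of_backward (h : IsStrictlyInward F a b)
    {w : ℕ → ℝ → EuclideanSpace ℝ ι} (hw : ∀ n : ℕ, IsSolutionOn F (w n) (Icc (-(n : ℝ)) 0))
    (hmem : ∀ n : ℕ, ∀ t ∈ Icc (-(n : ℝ)) 0, w n t ∈ cuboid a b)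
    {C : Set (EuclideanSpace ℝ ι)} (hC : IsClosed C) (hwC : ∀ n, w n 0 ∈ C) :
    ∃ γ, IsFullSolution F γ ∧ (∀ t, γ t ∈ cuboid a b) ∧ γ 0 ∈ C := by
  obtain ⟨K, hK⟩ := h.exists_lipschitzWith_comp_clamp
  choose φ hφ hφ0 using h.exists_isFullSolution_comp_clamp
  have heq : ∀ n : ℕ, EqOn (φ (w n 0)) (w n) (Icc (-(n : ℝ)) 0) := fun n =>
    ((hφ _).isSolutionOn _).eqOn_of_right hK.locallyLipschitz ((hw n).comp_clamp (hmem n))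
      (hφ0 _)
  have h0 : ∀ n : ℕ, w n 0 ∈ cuboid a b := fun n => hmem n 0 ⟨by simp, le_rfl⟩
  -- A convergent subsequence of the states at time 0 suffices: solutions of the clamped field
  -- depend continuously on them at every fixed time.
  obtain ⟨c, hc, ψ, hψ, hlim⟩ := (isCompact_cuboid a b).tendsto_subseq h0
  have hlim' : ∀ t, Tendsto (fun n => φ (w (ψ n) 0) t) atTop (𝓝 (φ c t)) := by
    intro t
    rw [tendsto_iff_dist_tendsto_zero] at hlim ⊢
    refine squeeze_zero (fun _ => dist_nonneg)
      (fun n => (hφ (w (ψ n) 0)).dist_le_mul_exp_abs hK (hφ c) t) ?_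
    simp only [hφ0]
    simpa using hlim.mul_const (Real.exp (K * |t|))
  have hpast : ∀ t ≤ 0, φ c t ∈ cuboid a b := by
    intro t ht
    refine (isClosed_cuboid a b).mem_of_tendsto (hlim' t) ?_
    obtain ⟨N, hN⟩ := exists_nat_ge (-t)
    filter_upwards [eventually_ge_atTop N] with n hn
    have h1 : (N : ℝ) ≤ ψ n := by exact_mod_cast hn.trans (hψ.id_le n)
    have h2 : t ∈ Icc (-(ψ n : ℝ)) 0 := ⟨by linarith, ht⟩
    rw [heq _ h2]
    exact hmem _ t h2
  have hall : ∀ t, φ c t ∈ cuboid a b := by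
    intro t
    rcases le_total t 0 with ht | ht
    · exact hpast t ht
    · exact h.mem_of_comp_clamp ((hφ c).isSolutionOn (Icc 0 t)) (hpast 0 le_rfl) t ⟨ht, le_rfl⟩
  refine ⟨φ c, ?_, hall, ?_⟩
  · exact isIntegralCurveOn_univ.1
      (((hφ c).isSolutionOn univ).of_comp_clamp fun t _ => hall t)
  · rw [hφ0]
    exact hC.mem_of_tendsto hlim (Eventually.of_forall fun n => hwC _)

end IsStrictlyInward

end Cuboid

/-! ### Elementary estimates for the planar model -/

/-- The relative growth rate `x' / x` of the first coordinate in the planar model. -/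
def growthRate (ν : ℝ) (z : EuclideanSpace ℝ (Fin 2)) : ℝ :=
  ν - z 0 ^ 2 + z 0 ^ 2 * z 1 + z 1 ^ 2

/-- The isolating box `[-√(1/50), √(1/50)] × [-1/100, 1/100]`. -/
def modelBox : Set (EuclideanSpace ℝ (Fin 2)) :=
  cuboid (boxLower (1 / 100)) (boxUpper (1 / 100))

theorem modelField_zero (ν : ℝ) (z : EuclideanSpace ℝ (Fin 2)) :
    modelField ν z 0 = z 0 * growthRate ν z := by
  simp [modelField, growthRate]
  ring

theorem modelField_one (ν : ℝ) (z : EuclideanSpace ℝ (Fin 2)) :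
    modelField ν z 1 = -z 1 + z 0 ^ 2 * z 1 + z 0 ^ 4 := by
  simp [modelField]

theorem mem_modelBox {z : EuclideanSpace ℝ (Fin 2)} :
    z ∈ modelBox ↔ z 0 ^ 2 ≤ 1 / 50 ∧ |z 1| ≤ 1 / 100 := by
  have h : (2 : ℝ) * (1 / 100) = 1 / 50 := by norm_num
  simp only [modelBox, cuboid, boxLower, boxUpper, Fin.forall_fin_two, mem_ofPred_eq, mem_Icc,
    Matrix.cons_val_zero, Matrix.cons_val_one, ← abs_le, h]
  rw [Real.sq_le (by norm_num), ← abs_le]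

theorem contDiff_modelField (ν : ℝ) : ContDiff ℝ 1 (modelField ν) := by
  rw [contDiff_euclidean]
  intro i
  fin_cases i
  · simp only [modelField]
    simp
    fun_prop
  · simp only [modelField]
    simp
    fun_prop

theorem locallyLipschitz_modelField (ν : ℝ) : LocallyLipschitz (modelField ν) :=
  (contDiff_modelField ν).locallyLipschitz

/-- The number 3/20 is a rational upper bound for √(1/50). -/
theorem abs_le_of_mem_modelBox {z : EuclideanSpace ℝ (Fin 2)} (hz : z ∈ modelBox) :
    |z 0| ≤ 3 / 20 :=
  abs_le_of_sq_le_sq (by nlinarith [(mem_modelBox.1 hz).1]) (by norm_num)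

theorem growthRate_abs_le {ν : ℝ} (hν : |ν| ≤ 1 / 100) {z : EuclideanSpace ℝ (Fin 2)}
    (hz : z ∈ modelBox) : |growthRate ν z| ≤ 1 / 2 := by
  obtain ⟨hx, hy⟩ := mem_modelBox.1 hz
  rw [abs_le] at *
  have := sq_nonneg (z 0)
  simp only [growthRate]
  constructor <;> nlinarith

/-- On the vertical sides x² = 1/50 is twice the largest |ν|, so -x² dominates the growth rate. On
the horizontal sides -y dominates, the other terms of y' being of order x²y and x⁴. -/
theorem isStrictlyInward_modelField {ν : ℝ} (hν : |ν| ≤ 1 / 100) :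
    IsStrictlyInward (modelField ν) (boxLower (1 / 100)) (boxUpper (1 / 100)) := by
  have hs : 0 < √(2 * (1 / 100) : ℝ) := Real.sqrt_pos.2 (by norm_num)
  have hs2 : √(2 * (1 / 100) : ℝ) ^ 2 = 1 / 50 := by rw [Real.sq_sqrt] <;> norm_num
  have hν' := abs_le.1 hν
  have hg : ∀ z ∈ modelBox, z 0 ^ 2 = 1 / 50 → growthRate ν z < 0 := by
    intro z hz hx
    obtain ⟨-, hy⟩ := mem_modelBox.1 hz
    rw [abs_le] at hy
    simp only [growthRate, hx]
    nlinarith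
  refine ⟨locallyLipschitz_modelField ν, ?_, ?_, ?_⟩
  · intro i
    fin_cases i
    · simp [boxLower, boxUpper]
    · norm_num [boxLower, boxUpper]
  · intro z hz i hi
    fin_cases i
    · replace hi : z 0 = √(2 * (1 / 100)) := hi
      show modelField ν z 0 < 0
      rw [modelField_zero]
      exact mul_neg_of_pos_of_neg (hi ▸ hs) (hg z hz (by rw [hi, hs2]))
    · replace hi : z 1 = 1 / 100 := hi
      show modelField ν z 1 < 0
      rw [modelField_one, hi]
      obtain ⟨hx, -⟩ := mem_modelBox.1 hz
      nlinarith [sq_nonneg (z 0)]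
  · intro z hz i hi
    fin_cases i
    · replace hi : z 0 = -√(2 * (1 / 100)) := hi
      show 0 < modelField ν z 0
      rw [modelField_zero]
      exact mul_pos_of_neg_of_neg (by rw [hi]; linarith) (hg z hz (by rw [hi, neg_sq, hs2]))
    · replace hi : z 1 = -(1 / 100) := hi
      show 0 < modelField ν z 1
      rw [modelField_one, hi]
      obtain ⟨hx, -⟩ := mem_modelBox.1 hz
      nlinarith [sq_nonneg (z 0), sq_nonneg (z 0 ^ 2)]

/-- The indefinite form `Δy² - Δx² / 4` of the difference of two points. -/
noncomputable def coneForm (z w : EuclideanSpace ℝ (Fin 2)) : ℝ :=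
  (z 1 - w 1) ^ 2 - (z 0 - w 0) ^ 2 / 4

theorem coneForm_deriv_le {ν : ℝ} (hν : |ν| ≤ 1 / 100) {z w : EuclideanSpace ℝ (Fin 2)}
    (hz : z ∈ modelBox) (hw : w ∈ modelBox) :
    2 * (z 1 - w 1) * (modelField ν z 1 - modelField ν w 1) -
      2 * (z 0 - w 0) * (modelField ν z 0 - modelField ν w 0) / 4 ≤ -1 * coneForm z w := by
  have hx₁ := abs_le_of_mem_modelBox hz
  have hx₂ := abs_le_of_mem_modelBox hw
  obtain ⟨hxs₁, hy₁⟩ := mem_modelBox.1 hz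
  obtain ⟨hxs₂, hy₂⟩ := mem_modelBox.1 hw
  rw [modelField_zero, modelField_zero, modelField_one, modelField_one]
  simp only [growthRate, coneForm]
  generalize z 0 = x₁ at *
  generalize z 1 = y₁ at *
  generalize w 0 = x₂ at *
  generalize w 1 = y₂ at *
  -- Exact factorisations of both differences through Δx and Δy: the four coefficients play the role
  -- of a Jacobian, with no mean value theorem. All are small except the -1 in front of Δy.
  have hX : x₁ * (ν - x₁ ^ 2 + x₁ ^ 2 * y₁ + y₁ ^ 2) - x₂ * (ν - x₂ ^ 2 + x₂ ^ 2 * y₂ + y₂ ^ 2) =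
      (ν - (x₁ ^ 2 + x₁ * x₂ + x₂ ^ 2) * (1 - y₁) + y₁ ^ 2) * (x₁ - x₂) +
      (x₂ ^ 3 + x₂ * (y₁ + y₂)) * (y₁ - y₂) := by ring
  have hY : (-y₁ + x₁ ^ 2 * y₁ + x₁ ^ 4) - (-y₂ + x₂ ^ 2 * y₂ + x₂ ^ 4) =
      ((x₁ + x₂) * (y₁ + x₁ ^ 2 + x₂ ^ 2)) * (x₁ - x₂) + (-1 + x₂ ^ 2) * (y₁ - y₂) := by ring
  rw [hX, hY]
  have hs1 := sq_nonneg x₁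
  have hs2 := sq_nonneg x₂
  have hA : |ν - (x₁ ^ 2 + x₁ * x₂ + x₂ ^ 2) * (1 - y₁) + y₁ ^ 2| ≤ 1 / 10 := by
    rw [abs_le] at *
    have h1 : 0 ≤ x₁ ^ 2 + x₁ * x₂ + x₂ ^ 2 := by nlinarith [sq_nonneg (x₁ + x₂)]
    have h2 : x₁ ^ 2 + x₁ * x₂ + x₂ ^ 2 ≤ 3 / 50 := by nlinarith [sq_nonneg (x₁ - x₂)]
    constructor <;> nlinarith
  have hB : |x₂ ^ 3 + x₂ * (y₁ + y₂)| ≤ 1 / 100 := by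
    have : x₂ ^ 3 + x₂ * (y₁ + y₂) = x₂ * (x₂ ^ 2 + (y₁ + y₂)) := by ring
    rw [this, abs_mul]
    have h2 : |x₂ ^ 2 + (y₁ + y₂)| ≤ 1 / 20 := by
      rw [abs_le] at *
      constructor <;> linarith
    nlinarith [abs_nonneg x₂, abs_nonneg (x₂ ^ 2 + (y₁ + y₂))]
  have hC : |(x₁ + x₂) * (y₁ + x₁ ^ 2 + x₂ ^ 2)| ≤ 1 / 50 := by
    rw [abs_mul]
    have h1 : |x₁ + x₂| ≤ 3 / 10 := (abs_add_le _ _).trans (by linarith)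
    have h2 : |y₁ + x₁ ^ 2 + x₂ ^ 2| ≤ 1 / 20 := by
      rw [abs_le] at *
      constructor <;> linarith
    nlinarith [abs_nonneg (x₁ + x₂), abs_nonneg (y₁ + x₁ ^ 2 + x₂ ^ 2)]
  generalize ν - (x₁ ^ 2 + x₁ * x₂ + x₂ ^ 2) * (1 - y₁) + y₁ ^ 2 = A at *
  generalize x₂ ^ 3 + x₂ * (y₁ + y₂) = B at *
  generalize (x₁ + x₂) * (y₁ + x₁ ^ 2 + x₂ ^ 2) = C at *
  generalize x₁ - x₂ = p at *
  generalize y₁ - y₂ = q at *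
  have hpq : |p * q| ≤ (p ^ 2 + q ^ 2) / 2 := by
    rw [abs_le]
    constructor <;> nlinarith [sq_nonneg (p + q), sq_nonneg (p - q)]
  have hM : |2 * C - B / 2| ≤ 1 / 20 := by
    rw [abs_le] at *
    constructor <;> linarith
  have hM2 : (2 * C - B / 2) * (p * q) ≤ 1 / 20 * ((p ^ 2 + q ^ 2) / 2) := by
    refine (le_abs_self _).trans ?_
    rw [abs_mul]
    exact mul_le_mul hM hpq (abs_nonneg _) (by norm_num)
  have hA2 : -(A * p ^ 2) ≤ 1 / 10 * p ^ 2 := by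
    nlinarith [(abs_le.1 hA).1, sq_nonneg p]
  have hE : x₂ ^ 2 * q ^ 2 ≤ 1 / 50 * q ^ 2 := mul_le_mul_of_nonneg_right hxs₂ (sq_nonneg q)
  nlinarith [sq_nonneg p, sq_nonneg q]

/-- Along the cones, the growth rate strictly decreases with the first coordinate. -/
theorem growthRate_sub_le {ν : ℝ} {z w : EuclideanSpace ℝ (Fin 2)} (hz : z ∈ modelBox)
    (hw : w ∈ modelBox) (hw0 : 0 ≤ w 0) (hwz : w 0 ≤ z 0)
    (hzw : |z 1 - w 1| ≤ (z 0 - w 0) / 2) (hz1 : |z 1| ≤ z 0 / 2) (hw1 : |w 1| ≤ w 0 / 2) :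
    growthRate ν z - growthRate ν w ≤ -((z 0 ^ 2 - w 0 ^ 2) / 2) := by
  have hx₂ := abs_le_of_mem_modelBox hw
  obtain ⟨-, hy₁⟩ := mem_modelBox.1 hz
  simp only [growthRate]
  generalize z 0 = x₁ at *
  generalize z 1 = y₁ at *
  generalize w 0 = x₂ at *
  generalize w 1 = y₂ at *
  rw [abs_of_nonneg hw0] at hx₂
  -- The y-terms can cost at most the fractions 1/4, 1/100 and 3/40 of x₁² - x₂², which leaves more
  -- than half of the leading term.
  have h1 : (y₁ - y₂) * (y₁ + y₂) ≤ (x₁ - x₂) / 2 * ((x₁ + x₂) / 2) := by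
    refine (le_abs_self _).trans ?_
    rw [abs_mul]
    exact mul_le_mul hzw ((abs_add_le _ _).trans (by linarith)) (abs_nonneg _) (by linarith)
  have h2 : x₂ ^ 2 * (y₁ - y₂) ≤ x₂ ^ 2 * ((x₁ - x₂) / 2) :=
    mul_le_mul_of_nonneg_left ((le_abs_self _).trans hzw) (sq_nonneg _)
  have h3 : (x₁ - x₂) * (x₁ + x₂) * y₁ ≤ (x₁ - x₂) * (x₁ + x₂) * (1 / 100) :=
    mul_le_mul_of_nonneg_left ((le_abs_self _).trans hy₁)
      (mul_nonneg (by linarith) (by linarith))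
  have h4 : x₂ ^ 2 * ((x₁ - x₂) / 2) ≤ (x₁ - x₂) * (x₁ + x₂) * (3 / 40) := by
    have : x₂ ^ 2 ≤ 3 / 20 * (x₁ + x₂) := by nlinarith
    nlinarith
  nlinarith [mul_nonneg (sub_nonneg.2 hwz) (by linarith : 0 ≤ x₁ + x₂)]

/-! ### Solutions of the planar model that stay in the box -/

section Model

variable {ν a b : ℝ} {u v : ℝ → EuclideanSpace ℝ (Fin 2)} {P : EuclideanSpace ℝ (Fin 2)}

theorem nonpos_of_forall_le_mul_exp {c C k : ℝ} (hk : 0 < k)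
    (h : ∀ T, 0 ≤ T → c ≤ C * Real.exp (-k * T)) : c ≤ 0 := by
  have hlim : Tendsto (fun T : ℝ => C * Real.exp (-k * T)) atTop (𝓝 (C * 0)) :=
    (Real.tendsto_exp_atBot.comp
      (tendsto_id.const_mul_atTop_of_neg (by linarith : -k < 0))).const_mul C
  rw [mul_zero] at hlim
  exact ge_of_tendsto hlim ((eventually_ge_atTop 0).mono h)

theorem forall_gt_of_ne {f : ℝ → ℝ} (hf : Continuous f) {c t₀ : ℝ} (hne : ∀ t, f t ≠ c)
    (h0 : c < f t₀) (t : ℝ) : c < f t := by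
  by_contra! h
  obtain ⟨s, hs⟩ := mem_range_of_exists_le_of_exists_ge hf ⟨t, h⟩ ⟨t₀, h0.le⟩
  exact hne s hs

theorem norm_le_abs_add_abs (z : EuclideanSpace ℝ (Fin 2)) : ‖z‖ ≤ |z 0| + |z 1| := by
  rw [EuclideanSpace.norm_eq, Fin.sum_univ_two, Real.norm_eq_abs, Real.norm_eq_abs]
  refine Real.sqrt_le_iff.2 ⟨by positivity, ?_⟩
  nlinarith [abs_nonneg (z 0), abs_nonneg (z 1)]

theorem coneForm_nonpos_iff {z w : EuclideanSpace ℝ (Fin 2)} :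
    coneForm z w ≤ 0 ↔ |z 1 - w 1| ≤ |z 0 - w 0| / 2 := by
  rw [coneForm, sub_nonpos, ← sq_abs, ← sq_abs (z 0 - w 0)]
  rw [← sq_le_sq₀ (abs_nonneg _) (by positivity : 0 ≤ |z 0 - w 0| / 2)]
  ring_nf

theorem zero_mem_modelBox : (0 : EuclideanSpace ℝ (Fin 2)) ∈ modelBox :=
  mem_modelBox.2 (by norm_num)

theorem modelField_apply_zero (ν : ℝ) : modelField ν 0 = 0 := by
  ext i
  fin_cases i <;> simp [modelField]

theorem isFullSolution_const (hP : modelField ν P = 0) :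
    IsFullSolution (modelField ν) fun _ => P :=
  isIntegralCurve_const fun _ => hP

theorem coneForm_le_mul_exp (hν : |ν| ≤ 1 / 100) (hab : a ≤ b)
    (hu : IsSolutionOn (modelField ν) u (Icc a b)) (hub : ∀ t ∈ Icc a b, u t ∈ modelBox)
    (hv : IsSolutionOn (modelField ν) v (Icc a b)) (hvb : ∀ t ∈ Icc a b, v t ∈ modelBox) :
    coneForm (u b) (v b) ≤ coneForm (u a) (v a) * Real.exp (-1 * (b - a)) := by
  refine le_mul_exp_of_hasDerivWithinAt_le (f := fun t => coneForm (u t) (v t))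
    (f' := fun t => 2 * (u t 1 - v t 1) * (modelField ν (u t) 1 - modelField ν (v t) 1) -
      2 * (u t 0 - v t 0) * (modelField ν (u t) 0 - modelField ν (v t) 0) / 4) hab
    (fun t ht => ?_) (fun t ht => coneForm_deriv_le hν (hub t ht) (hvb t ht))
  have h := fun i => (hasDerivWithinAt_coord (hu t ht) i).sub (hasDerivWithinAt_coord (hv t ht) i)
  exact (((h 1).pow 2).sub (((h 0).pow 2).div_const 4)).congr_deriv (by simp)

/-- The cone form decays like exp(-T) from time `t - T` to `t`, while on the box it is at most 1.
Letting T grow shows that it is nonpositive. -/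
theorem abs_sub_le_of_isFullSolution (hν : |ν| ≤ 1 / 100) (hu : IsFullSolution (modelField ν) u)
    (hub : ∀ t, u t ∈ modelBox) (hv : IsFullSolution (modelField ν) v)
    (hvb : ∀ t, v t ∈ modelBox) (t : ℝ) : |u t 1 - v t 1| ≤ |u t 0 - v t 0| / 2 := by
  rw [← coneForm_nonpos_iff]
  refine nonpos_of_forall_le_mul_exp (C := 1) one_pos fun T hT => ?_
  have h := coneForm_le_mul_exp hν (by linarith : t - T ≤ t) (hu.isSolutionOn _)
    (fun s _ => hub s) (hv.isSolutionOn _) (fun s _ => hvb s)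
  rw [sub_sub_cancel] at h
  refine h.trans (mul_le_mul_of_nonneg_right ?_ (Real.exp_pos _).le)
  have h1 := abs_le.1 (mem_modelBox.1 (hub (t - T))).2
  have h2 := abs_le.1 (mem_modelBox.1 (hvb (t - T))).2
  rw [coneForm]
  nlinarith [sq_nonneg (u (t - T) 0 - v (t - T) 0)]

theorem abs_le_of_isFullSolution (hν : |ν| ≤ 1 / 100) (hu : IsFullSolution (modelField ν) u)
    (hub : ∀ t, u t ∈ modelBox) (t : ℝ) : |u t 1| ≤ |u t 0| / 2 := by
  simpa using abs_sub_le_of_isFullSolution hν hu hub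
    (isFullSolution_const (modelField_apply_zero ν)) (fun _ => zero_mem_modelBox) t

theorem hasDerivWithinAt_sq_fst {s : Set ℝ} (hu : IsSolutionOn (modelField ν) u s) {t : ℝ}
    (ht : t ∈ s) : HasDerivWithinAt (fun t => u t 0 ^ 2) (2 * growthRate ν (u t) * u t 0 ^ 2) s t := by
  have h := (hasDerivWithinAt_coord (hu t ht) 0).pow 2
  rw [modelField_zero] at h
  exact h.congr_deriv (by simp; ring)

/-- An upper bound of the growth rate bounds the growth of `x²` from above. -/
theorem sq_fst_le_mul_exp (hab : a ≤ b) (hu : IsSolutionOn (modelField ν) u (Icc a b)) {k : ℝ}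
    (hk : ∀ t ∈ Icc a b, growthRate ν (u t) ≤ -k) :
    u b 0 ^ 2 ≤ u a 0 ^ 2 * Real.exp (-(2 * k) * (b - a)) :=
  le_mul_exp_of_hasDerivWithinAt_le (f := fun t => u t 0 ^ 2) hab
    (fun _ ht => hasDerivWithinAt_sq_fst hu ht)
    (fun t ht => mul_le_mul_of_nonneg_right (by linarith [hk t ht]) (sq_nonneg _))

/-- A lower bound of the growth rate bounds the growth of `x²` from below. -/
theorem mul_exp_le_sq_fst (hab : a ≤ b) (hu : IsSolutionOn (modelField ν) u (Icc a b)) {k : ℝ}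
    (hk : ∀ t ∈ Icc a b, k ≤ growthRate ν (u t)) :
    u a 0 ^ 2 * Real.exp (2 * k * (b - a)) ≤ u b 0 ^ 2 := by
  have := le_mul_exp_of_hasDerivWithinAt_le (f := fun t => -(u t 0 ^ 2)) (k := -(2 * k)) hab
    (fun _ ht => (hasDerivWithinAt_sq_fst hu ht).neg)
    (fun t ht => by nlinarith [hk t ht, sq_nonneg (u t 0)])
  simp only [neg_neg] at this
  linarith

/-- The growth rate is bounded on both sides, so x² can neither vanish nor become positive in finite
time. -/
theorem fst_eq_zero_iff (hν : |ν| ≤ 1 / 100) (hab : a ≤ b)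
    (hu : IsSolutionOn (modelField ν) u (Icc a b)) (hub : ∀ t ∈ Icc a b, u t ∈ modelBox) :
    u a 0 = 0 ↔ u b 0 = 0 := by
  have h1 := sq_fst_le_mul_exp hab hu (k := -(1 / 2)) fun t ht => by
    linarith [(abs_le.1 (growthRate_abs_le hν (hub t ht))).2]
  have h2 := mul_exp_le_sq_fst hab hu (k := -(1 / 2)) fun t ht =>
    (abs_le.1 (growthRate_abs_le hν (hub t ht))).1
  constructor
  · intro h
    rw [h] at h1
    exact pow_eq_zero_iff two_ne_zero |>.1 (le_antisymm (by simpa using h1) (sq_nonneg _))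
  · intro h
    rw [h] at h2
    by_contra hne
    have : 0 < u a 0 ^ 2 * Real.exp (2 * -(1 / 2) * (b - a)) := by positivity
    linarith

theorem fst_pos_of_isSolutionOn (hν : |ν| ≤ 1 / 100)
    (hu : IsSolutionOn (modelField ν) u (Icc a b)) (hub : ∀ t ∈ Icc a b, u t ∈ modelBox)
    (h0 : 0 < u a 0) : ∀ t ∈ Icc a b, 0 < u t 0 := by
  intro t ht
  by_contra! hle
  have hc : ContinuousOn (fun t => u t 0) (Icc a t) := fun s hs =>
    (hasDerivWithinAt_coord (hu s ⟨hs.1, hs.2.trans ht.2⟩) 0).continuousWithinAt.mono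
      (Icc_subset_Icc_right ht.2)
  obtain ⟨s, hs, hs0⟩ := intermediate_value_Icc' ht.1 hc ⟨hle, h0.le⟩
  have hsub : Icc a s ⊆ Icc a b := Icc_subset_Icc_right (hs.2.trans ht.2)
  exact h0.ne' ((fst_eq_zero_iff hν hs.1 (hu.mono hsub) fun r hr => hub r (hsub hr)).2 hs0)

theorem fst_pos_of_isFullSolution (hν : |ν| ≤ 1 / 100) (hu : IsFullSolution (modelField ν) u)
    (hub : ∀ t, u t ∈ modelBox) {t₀ : ℝ} (h0 : 0 < u t₀ 0) (t : ℝ) : 0 < u t 0 := by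
  have hc : Continuous fun t => u t 0 := by
    have := IsIntegralCurve.continuous hu
    fun_prop
  refine forall_gt_of_ne hc (fun s hs => ?_) h0 t
  rcases le_total s t₀ with h | h
  · exact h0.ne' ((fst_eq_zero_iff hν h (hu.isSolutionOn _) fun r _ => hub r).1 hs)
  · exact h0.ne' ((fst_eq_zero_iff hν h (hu.isSolutionOn _) fun r _ => hub r).2 hs)

/-- In the cone at the origin y² ≤ x²/4, so for ν ≤ 0 the growth rate is at most -x²/2. Then x² does
not decrease backwards in time, and its backward growth is exponential unless it vanishes, which
contradicts boundedness. -/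
theorem eq_zero_of_nonpos_param (hν : |ν| ≤ 1 / 100) (hν0 : ν ≤ 0)
    (hu : IsFullSolution (modelField ν) u) (hub : ∀ t, u t ∈ modelBox) : u 0 = 0 := by
  have hcone := abs_le_of_isFullSolution hν hu hub
  have hg : ∀ t, growthRate ν (u t) ≤ -(u t 0 ^ 2 / 2) := by
    intro t
    have h1 := (abs_le.1 (mem_modelBox.1 (hub t)).2).2
    have h2 : u t 1 ^ 2 ≤ u t 0 ^ 2 / 4 := by
      rw [← sq_abs (u t 1), ← sq_abs (u t 0)]
      nlinarith [hcone t, abs_nonneg (u t 1)]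
    rw [growthRate]
    nlinarith [sq_nonneg (u t 0)]
  have hx : u 0 0 ^ 2 ≤ 0 := by
    by_contra! hpos
    have hge : ∀ t ≤ 0, u 0 0 ^ 2 ≤ u t 0 ^ 2 := by
      intro t ht
      simpa using sq_fst_le_mul_exp ht (hu.isSolutionOn _) (k := 0) fun s _ =>
        (hg s).trans (by simpa using by positivity)
    refine hpos.not_ge (nonpos_of_forall_le_mul_exp (C := 1) hpos fun T hT => ?_)
    have := sq_fst_le_mul_exp (by linarith : -T ≤ 0) (hu.isSolutionOn _) (k := u 0 0 ^ 2 / 2)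
      fun s hs => (hg s).trans (by linarith [hge s hs.2])
    have h1 := (mem_modelBox.1 (hub (-T))).1
    calc u 0 0 ^ 2 ≤ u (-T) 0 ^ 2 * Real.exp (-(2 * (u 0 0 ^ 2 / 2)) * (0 - -T)) := this
      _ ≤ 1 * Real.exp (-(2 * (u 0 0 ^ 2 / 2)) * (0 - -T)) :=
        mul_le_mul_of_nonneg_right (by linarith) (Real.exp_pos _).le
      _ = 1 * Real.exp (-(u 0 0 ^ 2) * T) := by ring_nf
  have hx0 : u 0 0 = 0 := pow_eq_zero_iff two_ne_zero |>.1 (le_antisymm hx (sq_nonneg _))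
  have hy0 : u 0 1 = 0 := by simpa [hx0] using hcone 0
  ext i
  fin_cases i
  · exact hx0
  · exact hy0

theorem eq_const_of_fst_eq (hν : |ν| ≤ 1 / 100) (hP : modelField ν P = 0) (hPb : P ∈ modelBox)
    (hu : IsFullSolution (modelField ν) u) (hub : ∀ t, u t ∈ modelBox) {t : ℝ}
    (h : u t 0 = P 0) : u = fun _ => P := by
  refine hu.eq_of_apply_eq (locallyLipschitz_modelField ν) (isFullSolution_const hP) (t₀ := t) ?_
  have := abs_sub_le_of_isFullSolution hν hu hub (isFullSolution_const hP) (fun _ => hPb) t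
  ext i
  fin_cases i
  · exact h
  · simpa [h, sub_eq_zero] using this

theorem growthRate_eq_zero (hP : modelField ν P = 0) (hP0 : P 0 ≠ 0) : growthRate ν P = 0 := by
  have := modelField_zero ν P
  rw [hP] at this
  simpa [hP0] using this.symm

/-- Inside the cones at the origin and at the fixed point `P`, the sign of the growth rate is
determined by the position of the first coordinate relative to that of `P`. -/
theorem growthRate_ge_of_le {z : EuclideanSpace ℝ (Fin 2)} (hν : |ν| ≤ 1 / 100)
    (hP : modelField ν P = 0) (hPb : P ∈ modelBox) (hP0 : 0 < P 0) (hz : z ∈ modelBox)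
    (hz0 : 0 ≤ z 0) (hzP : z 0 ≤ P 0) (hcone : |z 1| ≤ |z 0| / 2)
    (hconeP : |z 1 - P 1| ≤ |z 0 - P 0| / 2) : (P 0 ^ 2 - z 0 ^ 2) / 2 ≤ growthRate ν z := by
  have hP1 := abs_le_of_isFullSolution hν (isFullSolution_const hP) (fun _ => hPb) 0
  rw [abs_of_pos hP0] at hP1
  rw [abs_of_nonneg hz0] at hcone
  rw [abs_sub_comm, abs_sub_comm (z 0), abs_of_nonneg (by linarith : 0 ≤ P 0 - z 0)] at hconeP
  have := growthRate_sub_le (ν := ν) hPb hz hz0 hzP hconeP hP1 hcone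
  rw [growthRate_eq_zero hP hP0.ne'] at this
  linarith

theorem growthRate_le_of_ge {z : EuclideanSpace ℝ (Fin 2)} (hν : |ν| ≤ 1 / 100)
    (hP : modelField ν P = 0) (hPb : P ∈ modelBox) (hP0 : 0 < P 0) (hz : z ∈ modelBox)
    (hzP : P 0 ≤ z 0) (hcone : |z 1| ≤ |z 0| / 2)
    (hconeP : |z 1 - P 1| ≤ |z 0 - P 0| / 2) : growthRate ν z ≤ -((z 0 ^ 2 - P 0 ^ 2) / 2) := by
  have hP1 := abs_le_of_isFullSolution hν (isFullSolution_const hP) (fun _ => hPb) 0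
  rw [abs_of_pos hP0] at hP1
  rw [abs_of_nonneg (hP0.le.trans hzP)] at hcone
  rw [abs_of_nonneg (by linarith : 0 ≤ z 0 - P 0)] at hconeP
  have := growthRate_sub_le (ν := ν) hz hPb hP0.le hzP hconeP hcone hP1
  rw [growthRate_eq_zero hP hP0.ne'] at this
  linarith

/-- A full solution in the right half of the box is the fixed point or stays strictly between
the origin and the fixed point. -/
theorem eq_const_or_fst_lt (hν : |ν| ≤ 1 / 100)
    (hP : modelField ν P = 0) (hPb : P ∈ modelBox) (hP0 : 0 < P 0)
    (hu : IsFullSolution (modelField ν) u) (hub : ∀ t, u t ∈ modelBox) (h0 : 0 < u 0 0) :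
    (u = fun _ => P) ∨ ∀ t, 0 < u t 0 ∧ u t 0 < P 0 := by
  have hpos := fst_pos_of_isFullSolution hν hu hub h0
  have hc : Continuous fun t => u t 0 := by
    have := IsIntegralCurve.continuous hu
    fun_prop
  by_cases hex : ∃ t, u t 0 = P 0
  · exact Or.inl (eq_const_of_fst_eq hν hP hPb hu hub hex.choose_spec)
  push Not at hex
  rcases lt_or_gt_of_ne (hex 0) with hlt | hgt
  · refine Or.inr fun t => ⟨hpos t, ?_⟩
    have := forall_gt_of_ne hc.neg (c := -P 0) (t₀ := 0) (fun s hs => hex s (neg_inj.1 hs))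
      (neg_lt_neg hlt) t
    simpa using this
  -- To the right of `P` the growth rate is negative, and going backwards it stays bounded away from
  -- zero; the orbit would leave the box in the past.
  · exfalso
    have hgt' := forall_gt_of_ne hc hex hgt
    have hg : ∀ t, growthRate ν (u t) ≤ -((u t 0 ^ 2 - P 0 ^ 2) / 2) := fun t =>
      growthRate_le_of_ge hν hP hPb hP0 (hub t) (hgt' t).le
        (abs_le_of_isFullSolution hν hu hub t)
        (abs_sub_le_of_isFullSolution hν hu hub (isFullSolution_const hP) (fun _ => hPb) t)
    have hsq : ∀ t, P 0 ^ 2 < u t 0 ^ 2 := fun t => by nlinarith [hgt' t]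
    have hge : ∀ t ≤ 0, u 0 0 ^ 2 ≤ u t 0 ^ 2 := by
      intro t ht
      simpa using sq_fst_le_mul_exp ht (hu.isSolutionOn _) (k := 0) fun s _ =>
        (hg s).trans (by linarith [hsq s])
    have hk : 0 < u 0 0 ^ 2 - P 0 ^ 2 := sub_pos.2 (hsq 0)
    have hx : u 0 0 ^ 2 ≤ 0 := by
      refine nonpos_of_forall_le_mul_exp (C := 1) hk fun T hT => ?_
      have := sq_fst_le_mul_exp (by linarith : -T ≤ 0) (hu.isSolutionOn _)
        (k := (u 0 0 ^ 2 - P 0 ^ 2) / 2) fun s hs => (hg s).trans (by linarith [hge s hs.2])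
      have h1 := (mem_modelBox.1 (hub (-T))).1
      calc u 0 0 ^ 2 ≤ _ := this
        _ ≤ 1 * Real.exp (-(2 * ((u 0 0 ^ 2 - P 0 ^ 2) / 2)) * (0 - -T)) :=
          mul_le_mul_of_nonneg_right (by linarith) (Real.exp_pos _).le
        _ = 1 * Real.exp (-(u 0 0 ^ 2 - P 0 ^ 2) * T) := by ring_nf
    nlinarith

theorem tendsto_of_tendsto_fst {l : Filter ℝ}
    (hcone : ∀ t, |u t 1 - P 1| ≤ |u t 0 - P 0| / 2)
    (h : Tendsto (fun t => u t 0) l (𝓝 (P 0))) : Tendsto u l (𝓝 P) := by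
  rw [tendsto_iff_norm_sub_tendsto_zero] at h ⊢
  refine squeeze_zero (fun _ => norm_nonneg _) (fun t => norm_le_abs_add_abs _) ?_
  refine squeeze_zero (fun _ => by positivity) (g := fun t => 3 / 2 * ‖u t 0 - P 0‖) (fun t => ?_)
    (by simpa using h.const_mul (3 / 2))
  have := hcone t
  simp only [PiLp.sub_apply, Real.norm_eq_abs]
  linarith

/-- Between the origin and `P` the rate is at least (P₀² - x²)/2, so x² is monotone. Backwards, the
rate is bounded below by its value for x(0), and x² decays exponentially; forwards, the gap P₀² - x²
decays at rate x(0)². The cones make the second coordinate follow. -/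
theorem isHeteroclinicConnection_of_fst_lt (hν : |ν| ≤ 1 / 100)
    (hP : modelField ν P = 0) (hPb : P ∈ modelBox) (hP0 : 0 < P 0)
    (hu : IsFullSolution (modelField ν) u) (hub : ∀ t, u t ∈ modelBox)
    (hlt : ∀ t, 0 < u t 0 ∧ u t 0 < P 0) : IsHeteroclinicConnection (modelField ν) 0 P u := by
  have hconeP := abs_sub_le_of_isFullSolution hν hu hub (isFullSolution_const hP) (fun _ => hPb)
  have hcone := abs_le_of_isFullSolution hν hu hub
  have hg : ∀ t, (P 0 ^ 2 - u t 0 ^ 2) / 2 ≤ growthRate ν (u t) := fun t =>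
    growthRate_ge_of_le hν hP hPb hP0 (hub t) (hlt t).1.le (hlt t).2.le (hcone t) (hconeP t)
  have hsq : ∀ t, u t 0 ^ 2 < P 0 ^ 2 := fun t => by nlinarith [hlt t]
  have hmono : ∀ s t, s ≤ t → u s 0 ^ 2 ≤ u t 0 ^ 2 := by
    intro s t hst
    simpa using mul_exp_le_sq_fst hst (hu.isSolutionOn _) (k := 0) fun r _ =>
      le_trans (by linarith [hsq r]) (hg r)
  refine ⟨hu, tendsto_of_tendsto_fst (by simpa using hcone) ?_, tendsto_of_tendsto_fst hconeP ?_⟩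
  · have hk : 0 < P 0 ^ 2 - u 0 0 ^ 2 := sub_pos.2 (hsq 0)
    have hb : ∀ t ≤ 0, u t 0 ^ 2 ≤ u 0 0 ^ 2 * Real.exp ((P 0 ^ 2 - u 0 0 ^ 2) * t) := by
      intro t ht
      have := mul_exp_le_sq_fst ht (hu.isSolutionOn _) (k := (P 0 ^ 2 - u 0 0 ^ 2) / 2)
        fun s hs => le_trans (by linarith [hmono s 0 hs.2]) (hg s)
      have h2 : 2 * ((P 0 ^ 2 - u 0 0 ^ 2) / 2) * (0 - t) = -((P 0 ^ 2 - u 0 0 ^ 2) * t) := by ring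
      rwa [h2, Real.exp_neg, ← div_eq_mul_inv, div_le_iff₀ (Real.exp_pos _)] at this
    have hlim : Tendsto (fun t => u t 0 ^ 2) atBot (𝓝 0) := by
      refine tendsto_of_tendsto_of_tendsto_of_le_of_le' tendsto_const_nhds ?_
        (Eventually.of_forall fun t => sq_nonneg _) ((eventually_le_atBot 0).mono hb)
      simpa using (Real.tendsto_exp_atBot.comp (tendsto_id.const_mul_atBot hk)).const_mul
        (u 0 0 ^ 2)
    have := hlim.sqrt
    simpa [Real.sqrt_sq, (hlt _).1.le] using this
  · have hb : ∀ t, 0 ≤ t →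
        P 0 ^ 2 - u t 0 ^ 2 ≤ (P 0 ^ 2 - u 0 0 ^ 2) * Real.exp (-(u 0 0 ^ 2) * t) := by
      intro t ht
      have := le_mul_exp_of_hasDerivWithinAt_le (f := fun t => P 0 ^ 2 - u t 0 ^ 2)
        (k := u 0 0 ^ 2) ht
        (fun s hs => (hasDerivWithinAt_sq_fst (hu.isSolutionOn _) hs).const_sub (P 0 ^ 2))
        (fun s hs => by
          have h1 := hmono 0 s hs.1
          have h2 := hg s
          have h3 := hsq s
          have h4 : 0 ≤ u 0 0 ^ 2 := sq_nonneg _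
          have h5 : (P 0 ^ 2 - u s 0 ^ 2) * u 0 0 ^ 2 ≤ 2 * growthRate ν (u s) * u s 0 ^ 2 :=
            mul_le_mul (by linarith) h1 h4 (by linarith)
          linarith)
      simpa using this
    have hlim : Tendsto (fun t => P 0 ^ 2 - u t 0 ^ 2) atTop (𝓝 0) := by
      refine tendsto_of_tendsto_of_tendsto_of_le_of_le' tendsto_const_nhds ?_
        (Eventually.of_forall fun t => (sub_pos.2 (hsq t)).le) ((eventually_ge_atTop 0).mono hb)
      have hk : -(u 0 0 ^ 2) < 0 := neg_neg_of_pos (pow_pos (hlt 0).1 2)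
      simpa using (Real.tendsto_exp_atBot.comp
        (tendsto_id.const_mul_atTop_of_neg hk)).const_mul (P 0 ^ 2 - u 0 0 ^ 2)
    have := (hlim.const_sub (P 0 ^ 2)).sqrt
    simpa [Real.sqrt_sq, (hlt _).1.le, hP0.le] using this

/-- The first coordinate of `v` sweeps the whole interval between 0 and P₀. Where it agrees with
that of `u 0`, the mutual cone condition forces the second coordinates to agree. -/
theorem exists_apply_eq_of_fst_lt (hν : |ν| ≤ 1 / 100)
    (hP : modelField ν P = 0) (hPb : P ∈ modelBox) (hP0 : 0 < P 0)
    (hv : IsFullSolution (modelField ν) v) (hvb : ∀ t, v t ∈ modelBox)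
    (hvlt : ∀ t, 0 < v t 0 ∧ v t 0 < P 0)
    (hu : IsFullSolution (modelField ν) u) (hub : ∀ t, u t ∈ modelBox)
    (hult : 0 < u 0 0 ∧ u 0 0 < P 0) : u 0 ∈ range v := by
  obtain ⟨-, hbot, htop⟩ := isHeteroclinicConnection_of_fst_lt hν hP hPb hP0 hv hvb hvlt
  have hproj : Continuous fun z : EuclideanSpace ℝ (Fin 2) => z 0 := by fun_prop
  have hbot' : Tendsto (fun t => v t 0) atBot (𝓝 0) := by
    simpa [Function.comp_def] using (hproj.tendsto 0).comp hbot
  have htop' : Tendsto (fun t => v t 0) atTop (𝓝 (P 0)) := (hproj.tendsto P).comp htop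
  obtain ⟨t, ht⟩ := mem_range_of_exists_le_of_exists_ge
    (hproj.comp (IsIntegralCurve.continuous hv))
    ((hbot'.eventually_lt_const hult.1).exists.imp fun _ h => h.le)
    ((htop'.eventually_const_lt hult.2).exists.imp fun _ h => h.le)
  refine ⟨t, ?_⟩
  have h := abs_sub_le_of_isFullSolution hν (hv.comp_add t) (fun s => hvb _) hu hub 0
  simp only [zero_add] at h
  replace ht : v t 0 = u 0 0 := ht
  ext i
  fin_cases i
  · exact ht
  · simpa [ht, sub_eq_zero] using h

end Model

/-! ### The connecting orbits and the maximal invariant sets -/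

theorem IsSolutionOn.comp_add {E : Type*} [NormedAddCommGroup E] [NormedSpace ℝ E] {F : E → E}
    {u : ℝ → E} {s r : Set ℝ} (hu : IsSolutionOn F u s) {c : ℝ} (h : ∀ t ∈ r, t + c ∈ s) :
    IsSolutionOn F (fun t => u (t + c)) r := by
  refine IsIntegralCurveOn.mono (IsIntegralCurveOn.comp_add hu c) fun t ht => ?_
  rw [Set.mem_vadd_set_iff_neg_vadd_mem, neg_neg, vadd_eq_add, add_comm]
  exact h t ht

section Connection

variable {ν : ℝ} {P : EuclideanSpace ℝ (Fin 2)}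

/-- The slope 1/4, better than the cone slope 1/2, ensures that points of the axis with 0 < x ≤ P₀/2
lie in the cone at `P`. It comes from inserting the weaker bound into y = x²y + x⁴. -/
theorem abs_snd_le_of_fixed (hν : |ν| ≤ 1 / 100) (hP : modelField ν P = 0) (hPb : P ∈ modelBox)
    (hP0 : 0 < P 0) : |P 1| ≤ P 0 / 4 := by
  have h1 := modelField_one ν P
  rw [hP] at h1
  have h2 : P 1 = P 0 ^ 2 * P 1 + P 0 ^ 4 := by
    have : (0 : EuclideanSpace ℝ (Fin 2)) 1 = 0 := rfl
    linarith
  have h3 := abs_le_of_isFullSolution hν (isFullSolution_const hP) (fun _ => hPb) 0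
  have h4 := abs_le_of_mem_modelBox hPb
  have h5 := (mem_modelBox.1 hPb).1
  rw [abs_of_pos hP0] at h3 h4
  have h6 : P 0 ^ 4 ≤ P 0 / 8 := by
    have : P 0 ^ 4 = P 0 * (P 0 * P 0 ^ 2) := by ring
    rw [this]
    nlinarith [mul_le_mul h4 h5 (sq_nonneg _) (by norm_num)]
  calc |P 1| = |P 0 ^ 2 * P 1 + P 0 ^ 4| := by rw [← h2]
    _ ≤ |P 0 ^ 2 * P 1| + |P 0 ^ 4| := abs_add_le _ _
    _ = P 0 ^ 2 * |P 1| + P 0 ^ 4 := by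
      rw [abs_mul, abs_of_nonneg (sq_nonneg (P 0)), abs_of_nonneg (by positivity : 0 ≤ P 0 ^ 4)]
    _ ≤ P 0 / 4 := by nlinarith [abs_nonneg (P 1)]

/-- Solutions that start on the axis close to the origin need a long time to get half way to the
fixed point, but they do get there. -/
theorem exists_solution_reaching_half (hν : |ν| ≤ 1 / 100) (hP : modelField ν P = 0)
    (hPb : P ∈ modelBox) (hP0 : 0 < P 0) (n : ℕ) :
    ∃ u T, IsSolutionOn (modelField ν) u (Ici 0) ∧ (∀ t, 0 ≤ t → u t ∈ modelBox) ∧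
      (n : ℝ) ≤ T ∧ u T 0 = P 0 / 2 := by
  -- Since x grows at most like exp(t/2), starting at this height forces a travel time of at least
  -- 2n.
  obtain ⟨x, hx⟩ : ∃ x, x = P 0 / 2 * Real.exp (-n) := ⟨_, rfl⟩
  have hx0 : 0 < x := by rw [hx]; positivity
  have hx1 : x ≤ P 0 / 2 := by
    rw [hx]
    exact mul_le_of_le_one_right (by positivity) (Real.exp_le_one_iff.2 (by simp))
  have hPsq := (mem_modelBox.1 hPb).1
  have hz : !₂[x, 0] ∈ modelBox := mem_modelBox.2 ⟨by
    have : x ^ 2 ≤ 1 / 50 := by nlinarith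
    simpa using this, by norm_num⟩
  obtain ⟨u, hu, hu0, hub⟩ := (isStrictlyInward_modelField hν).exists_isSolutionOn_Ici hz
  have hu0x : u 0 0 = x := by rw [hu0]; simp
  have hu0y : u 0 1 = 0 := by rw [hu0]; simp
  have hsol : ∀ T, IsSolutionOn (modelField ν) u (Icc 0 T) := fun T => hu.mono Icc_subset_Ici_self
  have hpres : ∀ Z, modelField ν Z = 0 → Z ∈ modelBox → |u 0 1 - Z 1| ≤ |u 0 0 - Z 0| / 2 →
      ∀ t, 0 ≤ t → |u t 1 - Z 1| ≤ |u t 0 - Z 0| / 2 := by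
    intro Z hZ hZb h t ht
    rw [← coneForm_nonpos_iff] at h ⊢
    exact (coneForm_le_mul_exp hν ht (hsol t) (fun s hs => hub s hs.1)
      ((isFullSolution_const hZ).isSolutionOn _) (fun _ _ => hZb)).trans
      (mul_nonpos_of_nonpos_of_nonneg h (Real.exp_pos _).le)
  have hcone : ∀ t, 0 ≤ t → |u t 1| ≤ |u t 0| / 2 := by
    simpa using hpres 0 (modelField_apply_zero ν) zero_mem_modelBox
      (by simp [hu0y]; positivity)
  have hconeP := hpres P hP hPb (by
    have h1 := abs_snd_le_of_fixed hν hP hPb hP0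
    rw [hu0x, hu0y, zero_sub, abs_neg, abs_sub_comm, abs_of_nonneg (by linarith : 0 ≤ P 0 - x)]
    linarith)
  have hpos : ∀ t, 0 ≤ t → 0 < u t 0 := fun t ht =>
    fst_pos_of_isSolutionOn hν (hsol t) (fun s hs => hub s hs.1) (hu0x ▸ hx0) t ⟨ht, le_rfl⟩
  obtain ⟨t, ht, hreach⟩ : ∃ t, 0 ≤ t ∧ P 0 / 2 ≤ u t 0 := by
    by_contra! hlt
    -- While x < P₀/2 the growth rate is at least (P₀² - P₀²/4)/2, so x² would grow with exponent
    -- 3/4 P₀² for ever.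
    have hk : 0 < 3 / 4 * P 0 ^ 2 := by positivity
    have hneg : x ^ 2 ≤ 0 := by
      refine nonpos_of_forall_le_mul_exp (C := 1) hk fun T hT => ?_
      have h := mul_exp_le_sq_fst hT (hsol T) (k := 3 / 8 * P 0 ^ 2) fun s hs => by
        have h1 := hpos s hs.1
        have h2 := hlt s hs.1
        refine le_trans ?_ (growthRate_ge_of_le hν hP hPb hP0 (hub s hs.1) h1.le
          (by linarith) (hcone s hs.1) (hconeP s hs.1))
        nlinarith
      have h3 := (mem_modelBox.1 (hub T hT)).1
      rw [hu0x] at h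
      rw [neg_mul, Real.exp_neg, ← div_eq_mul_inv, le_div_iff₀ (Real.exp_pos _)]
      have h4 : 2 * (3 / 8 * P 0 ^ 2) * (T - 0) = 3 / 4 * P 0 ^ 2 * T := by ring
      rw [h4] at h
      linarith
    nlinarith
  have hc : ContinuousOn (fun t => u t 0) (Icc 0 t) := fun s hs =>
    (hasDerivWithinAt_coord (hsol t s hs) 0).continuousWithinAt
  obtain ⟨T, hT, hTx⟩ := intermediate_value_Icc ht hc ⟨hu0x ▸ hx1, hreach⟩
  refine ⟨u, T, hu, hub, ?_, hTx⟩
  have h := sq_fst_le_mul_exp hT.1 (hsol T) (k := -(1 / 2)) fun s hs => by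
    linarith [(abs_le.1 (growthRate_abs_le hν (hub s hs.1))).2]
  have hTx' : u T 0 = P 0 / 2 := hTx
  rw [hTx', hu0x, hx, mul_pow, ← Real.exp_nat_mul, mul_assoc, ← Real.exp_add] at h
  have h1 : 1 ≤ Real.exp (((2 : ℕ) : ℝ) * -(n : ℝ) + -(2 * -(1 / 2)) * (T - 0)) :=
    le_of_mul_le_mul_left (by simpa using h) (by positivity : 0 < (P 0 / 2) ^ 2)
  rw [Real.one_le_exp_iff] at h1
  have h2 : (0 : ℝ) ≤ n := by positivity
  push_cast at h1
  linarith

/-- Time shifts make the approximating solutions cross x = P₀/2 at time 0. This closed condition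
survives the limit and rules out the constant solution `P`. -/
theorem exists_isFullSolution_fst_lt (hν : |ν| ≤ 1 / 100) (hP : modelField ν P = 0)
    (hPb : P ∈ modelBox) (hP0 : 0 < P 0) :
    ∃ γ, IsFullSolution (modelField ν) γ ∧ (∀ t, γ t ∈ modelBox) ∧
      ∀ t, 0 < γ t 0 ∧ γ t 0 < P 0 := by
  choose u T hu hub hT hx using exists_solution_reaching_half hν hP hPb hP0
  have hadd : ∀ (n : ℕ), ∀ t ∈ Icc (-(n : ℝ)) 0, 0 ≤ t + T n := fun n t ht => by
    linarith [ht.1, hT n]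
  obtain ⟨γ, hγ, hγb, hγ0⟩ := (isStrictlyInward_modelField hν).exists_isFullSolution_of_backward
    (w := fun n t => u n (t + T n)) (fun n => (hu n).comp_add (hadd n))
    (fun n t ht => hub n _ (hadd n t ht))
    (C := (fun z : EuclideanSpace ℝ (Fin 2) => z 0) ⁻¹' {P 0 / 2})
    (isClosed_singleton.preimage (by fun_prop)) (fun n => by simpa using hx n)
  replace hγ0 : γ 0 0 = P 0 / 2 := hγ0
  refine ⟨γ, hγ, hγb, ?_⟩
  rcases eq_const_or_fst_lt hν hP hPb hP0 hγ hγb (by rw [hγ0]; positivity) with rfl | h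
  · exact absurd hγ0 (by linarith)
  · exact h

/-- The reflection `(x, y) ↦ (-x, y)`, a symmetry of the planar model. -/
noncomputable def reflectFst : EuclideanSpace ℝ (Fin 2) →L[ℝ] EuclideanSpace ℝ (Fin 2) :=
  LinearMap.toContinuousLinearMap
    { toFun := fun z => !₂[-z 0, z 1]
      map_add' := fun z w => by
        ext i
        fin_cases i <;> simp [add_comm]
      map_smul' := fun c z => by
        ext i
        fin_cases i <;> simp }

theorem reflectFst_apply (z : EuclideanSpace ℝ (Fin 2)) : reflectFst z = !₂[-z 0, z 1] := rfl

theorem reflectFst_reflectFst (z : EuclideanSpace ℝ (Fin 2)) : reflectFst (reflectFst z) = z := by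
  ext i
  fin_cases i <;> simp [reflectFst_apply]

theorem modelField_reflectFst (ν : ℝ) (z : EuclideanSpace ℝ (Fin 2)) :
    modelField ν (reflectFst z) = reflectFst (modelField ν z) := by
  ext i
  fin_cases i
  · simp [reflectFst_apply, modelField]
    ring
  · simp [reflectFst_apply, modelField, Even.neg_pow (by decide : Even 4)]

theorem reflectFst_mem_modelBox {z : EuclideanSpace ℝ (Fin 2)} (hz : z ∈ modelBox) :
    reflectFst z ∈ modelBox := by
  rw [mem_modelBox] at *
  simpa [reflectFst_apply] using hz

theorem IsFullSolution.reflectFst_comp {u : ℝ → EuclideanSpace ℝ (Fin 2)}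
    (hu : IsFullSolution (modelField ν) u) :
    IsFullSolution (modelField ν) (fun t => reflectFst (u t)) := by
  intro t
  have := reflectFst.hasFDerivAt.comp_hasDerivAt t (hu t)
  simpa only [modelField_reflectFst, Function.comp_def] using this

/-! ### All full orbits in the box -/

theorem fullOrbitsIn_modelBox_of_nonpos (hν : |ν| ≤ 1 / 100) (hν0 : ν ≤ 0) :
    fullOrbitsIn (modelField ν) modelBox = {0} := by
  ext z
  constructor
  · rintro ⟨u, hu, rfl, hub⟩
    exact eq_zero_of_nonpos_param hν hν0 hu hub
  · rintro rfl
    exact ⟨_, isFullSolution_const (modelField_apply_zero ν), rfl, fun _ => zero_mem_modelBox⟩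

/-- Orbits are sorted by the sign of the first coordinate at time 0. If it is zero, the cone at the
origin leaves only the origin; negative values are reflected to positive ones. -/
theorem exists_heteroclinic_and_fullOrbitsIn_eq (hν : |ν| ≤ 1 / 100) (hP : modelField ν P = 0)
    (hPb : P ∈ modelBox) (hP0 : 0 < P 0) :
    ∃ γm γp : ℝ → EuclideanSpace ℝ (Fin 2),
      IsHeteroclinicConnection (modelField ν) 0 (reflectFst P) γm ∧
      IsHeteroclinicConnection (modelField ν) 0 P γp ∧
      fullOrbitsIn (modelField ν) modelBox =
        {0, reflectFst P, P} ∪ range γm ∪ range γp := by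
  obtain ⟨γ, hγ, hγb, hγlt⟩ := exists_isFullSolution_fst_lt hν hP hPb hP0
  have hhet := isHeteroclinicConnection_of_fst_lt hν hP hPb hP0 hγ hγb hγlt
  have hright : ∀ u, IsFullSolution (modelField ν) u → (∀ t, u t ∈ modelBox) → 0 < u 0 0 →
      u 0 = P ∨ u 0 ∈ range γ := by
    intro u hu hub h0
    rcases eq_const_or_fst_lt hν hP hPb hP0 hu hub h0 with rfl | h
    · exact Or.inl rfl
    · exact Or.inr (exists_apply_eq_of_fst_lt hν hP hPb hP0 hγ hγb hγlt hu hub (h 0))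
  refine ⟨fun t => reflectFst (γ t), γ, ⟨hγ.reflectFst_comp, ?_, ?_⟩, hhet, ?_⟩
  · simpa [Function.comp_def] using (reflectFst.continuous.tendsto 0).comp hhet.2.1
  · exact (reflectFst.continuous.tendsto P).comp hhet.2.2
  ext z
  constructor
  · rintro ⟨u, hu, rfl, hub⟩
    rcases lt_trichotomy (u 0 0) 0 with h | h | h
    · rcases hright _ hu.reflectFst_comp (fun t => reflectFst_mem_modelBox (hub t))
        (by simpa [reflectFst_apply] using h) with h1 | ⟨t, ht⟩
      · left; left; right; left
        rw [← h1, reflectFst_reflectFst]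
      · left; right
        exact ⟨t, by simp only [ht, reflectFst_reflectFst]⟩
    · left; left; left
      have hy := abs_le_of_isFullSolution hν hu hub 0
      ext i
      fin_cases i
      · exact h
      · simpa [h] using hy
    · rcases hright u hu hub h with h1 | h1
      · left; left; right; right
        exact h1
      · exact Or.inr h1
  · rintro (((rfl | rfl | rfl) | ⟨t, rfl⟩) | ⟨t, rfl⟩)
    · exact ⟨_, isFullSolution_const (modelField_apply_zero ν), rfl, fun _ => zero_mem_modelBox⟩
    · exact ⟨_, isFullSolution_const (by rw [modelField_reflectFst, hP, map_zero]), rfl,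
        fun _ => reflectFst_mem_modelBox hPb⟩
    · exact ⟨_, isFullSolution_const hP, rfl, fun _ => hPb⟩
    · exact apply_mem_fullOrbitsIn hγ.reflectFst_comp
        (fun t => reflectFst_mem_modelBox (hγb t)) t
    · exact apply_mem_fullOrbitsIn hγ hγb t

end Connection

/-! ### Criteria for hyperbolicity and asymptotic stability -/

section Criteria

theorem exists_strongConeConditions {ι : Type*} [Fintype ι]
    {F : EuclideanSpace ℝ ι → EuclideanSpace ℝ ι} {p : EuclideanSpace ℝ ι}
    {A Q : EuclideanSpace ℝ ι →L[ℝ] EuclideanSpace ℝ ι} (hF : HasStrictFDerivAt F A p)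
    (hQ : IsSelfAdjoint Q) {l : ℝ} (hl : 0 < l) (h : ∀ v, l * ‖v‖ ^ 2 ≤ inner ℝ (Q (A v)) v) :
    ∃ U ∈ 𝓝 p, StrongConeConditions F U Q := by
  -- Both `c`, for the linearization error, and `δ`, for the perturbation of `Q`, are chosen to cost
  -- at most l/4 each. By symmetry of `Q` everything is counted twice, and 2(l - l/4 - l/4) = l.
  obtain ⟨c, hc⟩ : ∃ c, c = l / (4 * (‖Q‖ + 1)) := ⟨_, rfl⟩
  have hc0 : 0 < c := by rw [hc]; positivity
  have hcQ : ‖Q‖ * c ≤ l / 4 := by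
    rw [hc, mul_div_assoc', div_le_div_iff₀ (by positivity) (by norm_num)]
    nlinarith [norm_nonneg Q]
  obtain ⟨δ, hδ⟩ : ∃ δ, δ = l / (4 * (‖A‖ + c + 1)) := ⟨_, rfl⟩
  have hδ0 : 0 < δ := by rw [hδ]; positivity
  have hδA : δ * (‖A‖ + c) ≤ l / 4 := by
    rw [hδ, div_mul_eq_mul_div, div_le_div_iff₀ (by positivity) (by norm_num)]
    nlinarith [norm_nonneg A]
  have hev := hF.isLittleO.def hc0
  rw [nhds_prod_eq, eventually_prod_self_iff'] at hev
  obtain ⟨U, hU, hUF⟩ := hev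
  refine ⟨U, hU, hQ, l, hl, δ, hδ0, fun z₁ h₁ z₂ h₂ s hs => ?_⟩
  have he := hUF z₁ h₁ z₂ h₂
  simp only at he
  generalize z₁ - z₂ = v at *
  generalize F z₁ - F z₂ = D at *
  obtain ⟨e, rfl⟩ : ∃ e, D = A v + e := ⟨D - A v, by simp⟩
  rw [add_sub_cancel_left] at he
  have hsymm := (ContinuousLinearMap.isSelfAdjoint_iff_isSymmetric.1 hQ) v (A v + e)
  simp only [ContinuousLinearMap.coe_coe] at hsymm
  rw [inner_add_left, inner_add_left (Q v), hsymm, real_inner_comm _ v, inner_smul_left,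
    inner_smul_left, real_inner_comm (A v + e) v, map_add, inner_add_left]
  have hv2 : 0 ≤ ‖v‖ ^ 2 := sq_nonneg _
  have h1 : -(l / 4 * ‖v‖ ^ 2) ≤ inner ℝ (Q e) v := by
    refine (abs_le.1 ((abs_real_inner_le_norm _ _).trans ?_)).1
    calc ‖Q e‖ * ‖v‖ ≤ (‖Q‖ * (c * ‖v‖)) * ‖v‖ := by
          gcongr
          exact (Q.le_opNorm e).trans (by gcongr)
      _ = ‖Q‖ * c * ‖v‖ ^ 2 := by ring
      _ ≤ l / 4 * ‖v‖ ^ 2 := by gcongr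
  have h2 : -(l / 4 * ‖v‖ ^ 2) ≤ s * inner ℝ (A v + e) v := by
    refine (abs_le.1 ?_).1
    rw [abs_mul]
    calc |s| * |inner ℝ (A v + e) v| ≤ δ * ((‖A‖ * ‖v‖ + c * ‖v‖) * ‖v‖) := by
          gcongr
          · exact abs_le.2 hs
          · refine (abs_real_inner_le_norm _ _).trans ?_
            gcongr
            exact (norm_add_le _ _).trans (add_le_add (A.le_opNorm v) he)
      _ = δ * (‖A‖ + c) * ‖v‖ ^ 2 := by ring
      _ ≤ l / 4 * ‖v‖ ^ 2 := by gcongr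
  have h3 := h v
  simp only [conj_trivial]
  linarith

/-- Half of the dissipation absorbs the linearization error near `p`. Small spheres are then crossed
only inwards, which gives stability, and ‖u - p‖² decays like exp(-l t). -/
theorem isAttractingFixedPoint_of_dissipative {E : Type*} [NormedAddCommGroup E]
    [InnerProductSpace ℝ E] {F : E → E} {p : E} (hp : F p = 0) {A : E →L[ℝ] E}
    (hF : HasFDerivAt F A p) {l : ℝ} (hl : 0 < l) (h : ∀ v, inner ℝ (A v) v ≤ -l * ‖v‖ ^ 2)
    (hex : ∀ᶠ z in 𝓝 p, ∃ u, IsSolutionOn F u (Ici 0) ∧ u 0 = z) :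
    IsAttractingFixedPoint F p := by
  have hdiss : ∀ᶠ z in 𝓝 p, inner ℝ (F z) (z - p) ≤ -(l / 2) * ‖z - p‖ ^ 2 := by
    filter_upwards [hF.isLittleO.def (half_pos hl)] with z hz
    rw [hp, sub_zero] at hz
    have h1 := h (z - p)
    have h2 : inner ℝ (F z - A (z - p)) (z - p) ≤ l / 2 * ‖z - p‖ ^ 2 := by
      refine (real_inner_le_norm _ _).trans ?_
      nlinarith [norm_nonneg (z - p)]
    rw [inner_sub_left] at h2
    linarith
  obtain ⟨r, hr, hball⟩ := Metric.eventually_nhds_iff_ball.1 hdiss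
  have hderiv : ∀ {u : ℝ → E}, IsSolutionOn F u (Ici 0) → ∀ T, ∀ t ∈ Icc 0 T,
      HasDerivWithinAt (fun t => ‖u t - p‖ ^ 2) (2 * inner ℝ (F (u t)) (u t - p)) (Icc 0 T) t := by
    intro u hu T t ht
    have h1 := (((hu t ht.1).mono (Icc_subset_Ici_self : Icc 0 T ⊆ Ici 0)).sub_const p).norm_sq
    rwa [real_inner_comm] at h1
  have hstay : ∀ {u : ℝ → E} {ρ : ℝ}, IsSolutionOn F u (Ici 0) → 0 < ρ → ρ < r → ‖u 0 - p‖ ≤ ρ →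
      ∀ t, 0 ≤ t → ‖u t - p‖ ≤ ρ := by
    intro u ρ hu hρ hρr h0 t ht
    rcases ht.eq_or_lt with rfl | hlt
    · exact h0
    have := lt_of_hasDerivWithinAt_neg_of_boundary (c := ρ ^ 2) (hderiv hu t)
      (by gcongr) (fun s _ hs' => ?_) t ⟨hlt, le_rfl⟩
    · exact (pow_le_pow_iff_left₀ (norm_nonneg _) hρ.le two_ne_zero).1 this.le
    · have hsρ : ‖u s - p‖ = ρ := (pow_left_inj₀ (norm_nonneg _) hρ.le two_ne_zero).1 hs'
      have := hball (u s) (by rw [mem_ball_iff_norm, hsρ]; exact hρr)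
      rw [hs'] at this
      have : 0 < l / 2 * ρ ^ 2 := by positivity
      linarith
  refine ⟨hp, fun V hV => ?_, Metric.closedBall p (r / 2) ∩ {z | ∃ u, IsSolutionOn F u (Ici 0) ∧ u 0 = z},
    inter_mem (Metric.closedBall_mem_nhds p (half_pos hr)) hex, fun z hz => ⟨hz.2, ?_⟩⟩
  · obtain ⟨ε, hε, hεV⟩ := Metric.nhds_basis_closedBall.mem_iff.1 hV
    have hρ : 0 < min ε (r / 2) := lt_min hε (half_pos hr)
    refine ⟨Metric.closedBall p (min ε (r / 2)), Metric.closedBall_mem_nhds p hρ,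
      fun u hu h0 t ht => hεV ?_⟩
    rw [mem_closedBall_iff_norm] at h0 ⊢
    exact (hstay hu hρ ((min_le_right _ _).trans_lt (half_lt_self hr)) h0 t ht).trans
      (min_le_left _ _)
  · rintro u hu rfl
    have hin := hstay hu (half_pos hr) (half_lt_self hr) (mem_closedBall_iff_norm.1 hz.1)
    have hb : ∀ t, 0 ≤ t → ‖u t - p‖ ^ 2 ≤ ‖u 0 - p‖ ^ 2 * Real.exp (-l * t) := by
      intro t ht
      have := le_mul_exp_of_hasDerivWithinAt_le (k := l) ht (hderiv hu t) fun s hs => by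
        have := hball (u s) (by
          rw [mem_ball_iff_norm]
          exact (hin s hs.1).trans_lt (half_lt_self hr))
        linarith
      simpa using this
    have hlim : Tendsto (fun t => ‖u t - p‖ ^ 2) atTop (𝓝 0) := by
      refine tendsto_of_tendsto_of_tendsto_of_le_of_le' tendsto_const_nhds ?_
        (Eventually.of_forall fun t => sq_nonneg _) ((eventually_ge_atTop 0).mono hb)
      simpa using (Real.tendsto_exp_atBot.comp
        (tendsto_id.const_mul_atTop_of_neg (neg_neg_of_pos hl))).const_mul (‖u 0 - p‖ ^ 2)
    rw [tendsto_iff_norm_sub_tendsto_zero]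
    simpa [Real.sqrt_sq] using hlim.sqrt

/-- The diagonal operator `(x, y) ↦ (q x, -y)`. -/
noncomputable def diagOperator (q : ℝ) : EuclideanSpace ℝ (Fin 2) →L[ℝ] EuclideanSpace ℝ (Fin 2) :=
  LinearMap.toContinuousLinearMap
    { toFun := fun z => !₂[q * z 0, -z 1]
      map_add' := fun z w => by
        ext i
        fin_cases i <;> simp [mul_add, add_comm]
      map_smul' := fun c z => by
        ext i
        fin_cases i <;> simp [mul_left_comm] }

theorem diagOperator_apply (q : ℝ) (z : EuclideanSpace ℝ (Fin 2)) :
    diagOperator q z = !₂[q * z 0, -z 1] := rfl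

theorem isSelfAdjoint_diagOperator (q : ℝ) : IsSelfAdjoint (diagOperator q) := by
  rw [ContinuousLinearMap.isSelfAdjoint_iff_isSymmetric]
  intro z w
  simp [diagOperator_apply, PiLp.inner_apply, Fin.sum_univ_two]
  ring

/-- For a root iω the imaginary part of μ² - tr μ + det gives tr ω = 0, so ω = 0, and the real part
then gives det = 0. -/
theorem re_ne_zero_of_isRoot_charpoly_map
    {A : EuclideanSpace ℝ (Fin 2) →ₗ[ℝ] EuclideanSpace ℝ (Fin 2)}
    {a b c d : ℝ} (hA0 : ∀ v, A v 0 = a * v 0 + b * v 1) (hA1 : ∀ v, A v 1 = c * v 0 + d * v 1)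
    (hdet : a * d - b * c ≠ 0) (htr : a + d ≠ 0) {μ : ℂ}
    (hμ : (A.charpoly.map (algebraMap ℝ ℂ)).IsRoot μ) : μ.re ≠ 0 := by
  have hM : LinearMap.toMatrix (EuclideanSpace.basisFun (Fin 2) ℝ).toBasis
      (EuclideanSpace.basisFun (Fin 2) ℝ).toBasis A = !![a, b; c, d] := by
    ext i j
    fin_cases i <;> fin_cases j <;> simp [LinearMap.toMatrix_apply, hA0, hA1]
  rw [← LinearMap.charpoly_toMatrix A (EuclideanSpace.basisFun (Fin 2) ℝ).toBasis, hM,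
    Matrix.charpoly_fin_two] at hμ
  simp [Polynomial.IsRoot, Matrix.trace_fin_two, Matrix.det_fin_two] at hμ
  intro hre
  have h1 := congrArg Complex.re hμ
  have h2 := congrArg Complex.im hμ
  simp [pow_two, hre] at h1 h2
  rcases h2 with h2 | h2
  · exact htr h2
  · rw [h2] at h1
    apply hdet
    linarith

theorem isHyperbolicFixedPoint_of_quadratic
    {F : EuclideanSpace ℝ (Fin 2) → EuclideanSpace ℝ (Fin 2)} {p : EuclideanSpace ℝ (Fin 2)}
    (hF : ContDiff ℝ 1 F) (hp : F p = 0) {a b c d q l : ℝ}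
    (hA0 : ∀ v, fderiv ℝ F p v 0 = a * v 0 + b * v 1)
    (hA1 : ∀ v, fderiv ℝ F p v 1 = c * v 0 + d * v 1) (hl : 0 < l)
    (hq : ∀ x y : ℝ, l * (x ^ 2 + y ^ 2) ≤ q * (a * x + b * y) * x - (c * x + d * y) * y)
    (hdet : a * d - b * c ≠ 0) (htr : a + d ≠ 0) : IsHyperbolicFixedPoint F p := by
  have hs : HasStrictFDerivAt F (fderiv ℝ F p) p :=
    hF.contDiffAt.hasStrictFDerivAt one_ne_zero
  refine ⟨hp, ?_, hs.hasFDerivAt.differentiableAt, fun μ hμ =>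
    re_ne_zero_of_isRoot_charpoly_map hA0 hA1 hdet htr hμ⟩
  obtain ⟨U, hU, h⟩ := exists_strongConeConditions hs (isSelfAdjoint_diagOperator q) hl fun v => by
    rw [EuclideanSpace.real_norm_sq_eq, Fin.sum_univ_two]
    refine (hq (v 0) (v 1)).trans (le_of_eq ?_)
    simp [diagOperator_apply, PiLp.inner_apply, Fin.sum_univ_two, hA0, hA1]
    ring
  exact ⟨U, hU, _, h⟩

end Criteria

/-! ### The fixed points of the planar model -/

section FixedPoints

variable {ν : ℝ} {P : EuclideanSpace ℝ (Fin 2)}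

/-- The derivative is read off along the line t ↦ P + t v, where each coordinate is a polynomial in
one variable. -/
theorem fderiv_modelField_apply (ν : ℝ) (P v : EuclideanSpace ℝ (Fin 2)) :
    fderiv ℝ (modelField ν) P v 0 =
      (ν - 3 * P 0 ^ 2 + 3 * P 0 ^ 2 * P 1 + P 1 ^ 2) * v 0 + (P 0 ^ 3 + 2 * P 0 * P 1) * v 1 ∧
    fderiv ℝ (modelField ν) P v 1 =
      (2 * P 0 * P 1 + 4 * P 0 ^ 3) * v 0 + (-1 + P 0 ^ 2) * v 1 := by
  have hd : HasFDerivAt (modelField ν) (fderiv ℝ (modelField ν) P) P :=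
    ((contDiff_modelField ν).differentiable one_ne_zero P).hasFDerivAt
  have hline : HasDerivAt (fun t : ℝ => P + t • v) v 0 := by
    simpa using ((hasDerivAt_id (0 : ℝ)).smul_const v).const_add P
  have hcomp : HasDerivAt (fun t : ℝ => modelField ν (P + t • v)) (fderiv ℝ (modelField ν) P v) 0 :=
    HasFDerivAt.comp_hasDerivAt (l := modelField ν) (0 : ℝ) (by simpa using hd) hline
  have hcoord := fun i => hasDerivWithinAt_coord (hcomp.hasDerivWithinAt (s := univ)) i
  simp only [hasDerivWithinAt_univ] at hcoord
  have hx : HasDerivAt (fun t : ℝ => P 0 + t * v 0) (v 0) 0 := by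
    simpa using ((hasDerivAt_id (0 : ℝ)).mul_const (v 0)).const_add (P 0)
  have hy : HasDerivAt (fun t : ℝ => P 1 + t * v 1) (v 1) 0 := by
    simpa using ((hasDerivAt_id (0 : ℝ)).mul_const (v 1)).const_add (P 1)
  constructor
  · refine (hcoord 0).unique ?_
    have h := ((hx.mul ((hx.pow 2).const_sub ν)).add ((hx.pow 3).mul hy)).add (hx.mul (hy.pow 2))
    refine (h.congr_deriv ?_).congr_of_eventuallyEq (Eventually.of_forall fun t => ?_)
    · simp
      ring
    · simp [modelField]
  · refine (hcoord 1).unique ?_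
    have h := (hy.neg.add ((hx.pow 2).mul hy)).add (hx.pow 4)
    refine (h.congr_deriv ?_).congr_of_eventuallyEq (Eventually.of_forall fun t => ?_)
    · simp
      ring
    · simp [modelField]

theorem isHyperbolicFixedPoint_zero (hν : |ν| ≤ 1 / 100) (hν0 : ν ≠ 0) :
    IsHyperbolicFixedPoint (modelField ν) 0 := by
  have hν' := abs_le.1 hν
  have hpos := abs_pos.2 hν0
  -- Here `q` is the sign of ν: the form is indefinite at a saddle and negative definite at a sink.
  obtain ⟨q, hq⟩ : ∃ q : ℝ, q * ν = |ν| := by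
    rcases abs_choice ν with h | h
    · exact ⟨1, by rw [h, one_mul]⟩
    · exact ⟨-1, by rw [h, neg_one_mul]⟩
  refine isHyperbolicFixedPoint_of_quadratic (a := ν) (b := 0) (c := 0) (d := -1) (q := q)
    (l := |ν|) (contDiff_modelField ν) (modelField_apply_zero ν)
    (fun v => by simpa using (fderiv_modelField_apply ν 0 v).1)
    (fun v => by simpa using (fderiv_modelField_apply ν 0 v).2) hpos (fun x y => ?_)
    (by simpa using hν0) (by linarith)
  have h1 : q * (ν * x + 0 * y) * x = |ν| * x ^ 2 := by rw [← hq]; ring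
  rw [h1]
  nlinarith [sq_nonneg y]

/-- The symmetric part of the linearization at a nontrivial fixed point is negative definite. -/
theorem linearization_negDef (hP : modelField ν P = 0) (hPb : P ∈ modelBox)
    (hP0 : P 0 ≠ 0) (x y : ℝ) :
    ((ν - 3 * P 0 ^ 2 + 3 * P 0 ^ 2 * P 1 + P 1 ^ 2) * x + (P 0 ^ 3 + 2 * P 0 * P 1) * y) * x +
      ((2 * P 0 * P 1 + 4 * P 0 ^ 3) * x + (-1 + P 0 ^ 2) * y) * y ≤
    -P 0 ^ 2 * (x ^ 2 + y ^ 2) := by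
  have hg := growthRate_eq_zero hP hP0
  obtain ⟨hs, hy⟩ := mem_modelBox.1 hPb
  rw [abs_le] at hy
  rw [growthRate] at hg
  -- The vanishing growth rate at `P` eliminates ν and exhibits the factor P₀².
  have ha : ν - 3 * P 0 ^ 2 + 3 * P 0 ^ 2 * P 1 + P 1 ^ 2 = -2 * P 0 ^ 2 * (1 - P 1) := by
    linear_combination hg
  rw [ha]
  generalize P 0 = p at *
  generalize P 1 = r at *
  have hM : |5 * p ^ 2 + 4 * r| ≤ 1 / 5 := by
    rw [abs_le]
    constructor <;> nlinarith [sq_nonneg p]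
  -- The off-diagonal entries add up to p(5p² + 4r). Keeping the factor p with x matters, since the
  -- x-direction contracts only at order p².
  have hxy : |p * x * y| ≤ (p ^ 2 * x ^ 2 + y ^ 2) / 2 := by
    rw [abs_le]
    constructor <;> nlinarith [sq_nonneg (p * x + y), sq_nonneg (p * x - y)]
  have h1 : (5 * p ^ 2 + 4 * r) * (p * x * y) ≤ 1 / 5 * ((p ^ 2 * x ^ 2 + y ^ 2) / 2) := by
    refine (le_abs_self _).trans ?_
    rw [abs_mul]
    exact mul_le_mul hM hxy (abs_nonneg _) (by norm_num)
  have h2 : p ^ 2 * x ^ 2 * r ≤ p ^ 2 * x ^ 2 * (1 / 100) :=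
    mul_le_mul_of_nonneg_left hy.2 (by positivity)
  have h3 : p ^ 2 * y ^ 2 ≤ 1 / 50 * y ^ 2 := mul_le_mul_of_nonneg_right hs (sq_nonneg y)
  have h4 : 0 ≤ p ^ 2 * x ^ 2 := by positivity
  nlinarith [sq_nonneg y]

theorem isHyperbolicFixedPoint_of_fst_ne_zero (hP : modelField ν P = 0) (hPb : P ∈ modelBox)
    (hP0 : P 0 ≠ 0) : IsHyperbolicFixedPoint (modelField ν) P := by
  have hneg := linearization_negDef hP hPb hP0
  have hpos : 0 < P 0 ^ 2 := by positivity
  have hg := growthRate_eq_zero hP hP0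
  obtain ⟨hs, hy⟩ := mem_modelBox.1 hPb
  rw [abs_le] at hy
  rw [growthRate] at hg
  have ha : ν - 3 * P 0 ^ 2 + 3 * P 0 ^ 2 * P 1 + P 1 ^ 2 = -2 * P 0 ^ 2 * (1 - P 1) := by
    linear_combination hg
  refine isHyperbolicFixedPoint_of_quadratic (q := -1) (contDiff_modelField ν) hP
    (fun v => (fderiv_modelField_apply ν P v).1) (fun v => (fderiv_modelField_apply ν P v).2)
    hpos (fun x y => by linarith [hneg x y]) (ne_of_gt ?_) (ne_of_lt ?_)
  · have : (ν - 3 * P 0 ^ 2 + 3 * P 0 ^ 2 * P 1 + P 1 ^ 2) * (-1 + P 0 ^ 2) -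
        (P 0 ^ 3 + 2 * P 0 * P 1) * (2 * P 0 * P 1 + 4 * P 0 ^ 3) =
        P 0 ^ 2 * (2 * (1 - P 1) * (1 - P 0 ^ 2) -
          (P 0 ^ 2 + 2 * P 1) * (2 * P 1 + 4 * P 0 ^ 2)) := by
      rw [ha]
      ring
    rw [this]
    refine mul_pos hpos ?_
    nlinarith
  · rw [ha]
    nlinarith

theorem cuboid_mem_nhds {ι : Type*} [Fintype ι] {a b : ι → ℝ} {z : EuclideanSpace ℝ ι}
    (hz : ∀ i, z i ∈ Ioo (a i) (b i)) : cuboid a b ∈ 𝓝 z := by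
  have : ∀ᶠ w in 𝓝 z, ∀ i, w i ∈ Icc (a i) (b i) := eventually_all.2 fun i =>
    (by fun_prop : Continuous fun w : EuclideanSpace ℝ ι => w i).continuousAt.eventually
      (Icc_mem_nhds (hz i).1 (hz i).2)
  exact this

theorem isAttractingFixedPoint_of_fst_ne_zero (hν : |ν| ≤ 1 / 100) (hP : modelField ν P = 0)
    (hPb : P ∈ modelBox) (hP0 : P 0 ≠ 0) : IsAttractingFixedPoint (modelField ν) P := by
  have hin := isStrictlyInward_modelField hν
  -- The fixed point is interior to the box, because its constant solution is strictly inside after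
  -- positive time.
  have hnhds : cuboid (boxLower (1 / 100)) (boxUpper (1 / 100)) ∈ 𝓝 P := cuboid_mem_nhds fun i =>
    hin.mem_Ioo ((isFullSolution_const hP).isSolutionOn (Icc 0 1)) hPb i 1 ⟨one_pos, le_rfl⟩
  refine isAttractingFixedPoint_of_dissipative hP
    ((contDiff_modelField ν).differentiable one_ne_zero P).hasFDerivAt
    (by positivity : 0 < P 0 ^ 2) (fun v => ?_) ?_
  · rw [EuclideanSpace.real_norm_sq_eq, Fin.sum_univ_two]
    refine le_trans (le_of_eq ?_) (linearization_negDef hP hPb hP0 (v 0) (v 1))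
    obtain ⟨h0, h1⟩ := fderiv_modelField_apply ν P v
    simp [PiLp.inner_apply, Fin.sum_univ_two, h0, h1]
    ring
  · filter_upwards [hnhds] with z hz
    obtain ⟨u, hu, hu0, -⟩ := hin.exists_isSolutionOn_Ici hz
    exact ⟨u, hu, hu0⟩

/-- With s = x² the second equation gives y = s²/(1 - s), and the first, divided by x, becomes ν = s
- s y - y². As y is at most ν/10, the right-hand side passes through ν between s = ν/2 and s = 2ν.
-/
theorem exists_fixedPoint_mem_boxPlus (hν : ν ∈ Ioc (0 : ℝ) (1 / 100)) :
    ∃ P : EuclideanSpace ℝ (Fin 2), modelField ν P = 0 ∧ P ∈ boxPlus ν := by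
  obtain ⟨h0, h1⟩ := hν
  have hc : ContinuousOn (fun s : ℝ => s - s * (s ^ 2 / (1 - s)) - (s ^ 2 / (1 - s)) ^ 2)
      (Icc (ν / 2) (2 * ν)) := by
    have hne : ∀ s ∈ Icc (ν / 2) (2 * ν), 1 - s ≠ 0 := fun s hs => by linarith [hs.2]
    fun_prop (disch := assumption)
  have hb : ∀ s ∈ Icc (ν / 2) (2 * ν), 0 ≤ s ^ 2 / (1 - s) ∧ s ^ 2 / (1 - s) ≤ ν / 10 := by
    intro s hs
    have hs1 : 0 < 1 - s := by linarith [hs.2]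
    refine ⟨by positivity, ?_⟩
    rw [div_le_iff₀ hs1]
    nlinarith [hs.1, hs.2]
  obtain ⟨s, hs, hsν⟩ : ν ∈ (fun s : ℝ => s - s * (s ^ 2 / (1 - s)) - (s ^ 2 / (1 - s)) ^ 2) ''
      Icc (ν / 2) (2 * ν) := by
    refine intermediate_value_Icc (by linarith) hc ⟨?_, ?_⟩
    · obtain ⟨ha, -⟩ := hb (ν / 2) ⟨le_rfl, by linarith⟩
      nlinarith
    · obtain ⟨ha, hb'⟩ := hb (2 * ν) ⟨by linarith, le_rfl⟩
      nlinarith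
  obtain ⟨hr0, hr1⟩ := hb s hs
  have hs0 : 0 ≤ s := by linarith [hs.1]
  have hreq : s ^ 2 / (1 - s) * (1 - s) = s ^ 2 := div_mul_cancel₀ _ (by linarith [hs.2])
  simp only at hsν
  generalize s ^ 2 / (1 - s) = r at *
  have hsq : √s ^ 2 = s := Real.sq_sqrt hs0
  have hsq4 : √s ^ 4 = s ^ 2 := by
    rw [show √s ^ 4 = (√s ^ 2) ^ 2 by ring, hsq]
  refine ⟨!₂[√s, r], ?_, ?_⟩
  · ext i
    fin_cases i
    · show modelField ν !₂[√s, r] 0 = 0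
      rw [modelField_zero, growthRate]
      simp only [Matrix.cons_val_zero, Matrix.cons_val_one, hsq]
      have : ν - s + s * r + r ^ 2 = 0 := by linarith
      rw [this, mul_zero]
    · show modelField ν !₂[√s, r] 1 = 0
      rw [modelField_one]
      simp only [Matrix.cons_val_zero, Matrix.cons_val_one, hsq, hsq4]
      linarith
  · intro i
    fin_cases i
    · exact ⟨Real.sqrt_le_sqrt hs.1, Real.sqrt_le_sqrt hs.2⟩
    · exact ⟨show -ν ≤ r by linarith, show r ≤ ν by linarith⟩

theorem mem_modelBox_of_mem_boxPlus (hν : ν ∈ Ioc (0 : ℝ) (1 / 100)) (hP : P ∈ boxPlus ν) :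
    P ∈ modelBox ∧ 0 < P 0 := by
  obtain ⟨h0, h1⟩ := hν
  obtain ⟨hx, hx'⟩ : √(ν / 2) ≤ P 0 ∧ P 0 ≤ √(2 * ν) := hP 0
  have hy : -ν ≤ P 1 ∧ P 1 ≤ ν := hP 1
  have hpos : 0 < P 0 := (Real.sqrt_pos.2 (by linarith)).trans_le hx
  refine ⟨mem_modelBox.2 ⟨?_, (abs_le.2 hy).trans h1⟩, hpos⟩
  have := (Real.le_sqrt hpos.le (by linarith)).1 hx'
  linarith

theorem reflectFst_mem_boxMinus (hP : P ∈ boxPlus ν) : reflectFst P ∈ boxMinus ν := by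
  intro i
  fin_cases i
  · exact ⟨neg_le_neg (hP 0).2, neg_le_neg (hP 0).1⟩
  · exact hP 1

end FixedPoints

/-! ### Assembly of the pitchfork bifurcation -/

theorem mainTheorem1 :
    ∃ νm νp : ℝ, νm < 0 ∧ 0 < νp ∧
      ∃ um up : ℝ → EuclideanSpace ℝ (Fin 2),
        IsPitchforkBifurcation modelField νm νp ∅ (boxLower νp) (boxUpper νp) 0 um up ∧
        (∀ ν ∈ Icc νm νp,
          IsForwardInvariantSet (modelField ν) (cuboid (boxLower νp) (boxUpper νp))) ∧
        ∀ ν ∈ Ioc 0 νp,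
          um ν ∈ boxMinus ν ∧ up ν ∈ boxPlus ν ∧
          IsAttractingFixedPoint (modelField ν) (um ν) ∧
          IsAttractingFixedPoint (modelField ν) (up ν) := by
  -- The branch has to be a function of every real ν; outside (0, 1/100] it takes the irrelevant
  -- value 0.
  have hex : ∀ ν, ∃ P : EuclideanSpace ℝ (Fin 2), ν ∈ Ioc (0 : ℝ) (1 / 100) →
      modelField ν P = 0 ∧ P ∈ boxPlus ν := by
    intro ν
    by_cases hν : ν ∈ Ioc (0 : ℝ) (1 / 100)
    · exact (exists_fixedPoint_mem_boxPlus hν).imp fun P hP _ => hP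
    · exact ⟨0, fun h => absurd h hν⟩
  choose up hup using hex
  have habs : ∀ ν ∈ Icc (-(1 / 100) : ℝ) (1 / 100), |ν| ≤ 1 / 100 := fun ν hν => abs_le.2 hν
  have habs' : ∀ ν ∈ Ioc (0 : ℝ) (1 / 100), |ν| ≤ 1 / 100 := fun ν hν =>
    abs_le.2 ⟨by linarith [hν.1], hν.2⟩
  have hfix := fun ν hν => (hup ν hν).1
  have hmem := fun ν hν => (mem_modelBox_of_mem_boxPlus hν (hup ν hν).2).1
  have hpos := fun ν hν => (mem_modelBox_of_mem_boxPlus hν (hup ν hν).2).2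
  have hfix' : ∀ ν ∈ Ioc (0 : ℝ) (1 / 100), modelField ν (reflectFst (up ν)) = 0 := fun ν hν => by
    rw [modelField_reflectFst, hfix ν hν, map_zero]
  have hmem' := fun ν hν => reflectFst_mem_modelBox (hmem ν hν)
  have hneg : ∀ ν ∈ Ioc (0 : ℝ) (1 / 100), reflectFst (up ν) 0 < 0 := fun ν hν =>
    neg_neg_of_pos (hpos ν hν)
  have hz0 : (0 : EuclideanSpace ℝ (Fin 2)) 0 = 0 := rfl
  refine ⟨-(1 / 100), 1 / 100, by norm_num, by norm_num, fun ν => reflectFst (up ν), up, ?_, ?_, ?_⟩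
  · exact
      { neg := by norm_num
        pos := by norm_num
        isolating := ⟨1, fun ν hν =>
          (isStrictlyInward_modelField (habs ν hν)).isIsolatingCuboid one_pos⟩
        mem := zero_mem_modelBox
        fixed := fun ν _ => modelField_apply_zero ν
        hyperbolic := fun ν hν h0 => isHyperbolicFixedPoint_zero (habs ν hν) h0
        before := fun ν hν => by
          rw [← fullOrbitsIn_modelBox_of_nonpos
            (habs ν ⟨hν.1, hν.2.trans (by norm_num)⟩) hν.2]
          exact isMaximalInvariantSet_fullOrbitsIn (locallyLipschitz_modelField ν) _
        born_mem := fun ν hν => ⟨hmem' ν hν, hmem ν hν⟩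
        born_ne := fun ν hν => by
          refine ⟨fun h => (hneg ν hν).ne ?_, fun h => (hpos ν hν).ne' ?_, fun h => ?_⟩
          · rw [h, hz0]
          · rw [h, hz0]
          · have h1 := hneg ν hν
            rw [h] at h1
            exact h1.not_gt (hpos ν hν)
        born_hyperbolic := fun ν hν =>
          ⟨isHyperbolicFixedPoint_of_fst_ne_zero (hfix' ν hν) (hmem' ν hν) (hneg ν hν).ne,
            isHyperbolicFixedPoint_of_fst_ne_zero (hfix ν hν) (hmem ν hν) (hpos ν hν).ne'⟩
        after := fun ν hν => by
          obtain ⟨γm, γp, hm, hp, heq⟩ := exists_heteroclinic_and_fullOrbitsIn_eq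
            (habs' ν hν) (hfix ν hν) (hmem ν hν) (hpos ν hν)
          refine ⟨γm, γp, hm, hp, ?_⟩
          rw [← heq]
          exact isMaximalInvariantSet_fullOrbitsIn (locallyLipschitz_modelField ν) _ }
  · exact fun ν hν => (isStrictlyInward_modelField (habs ν hν)).isForwardInvariantSet
  · exact fun ν hν => ⟨reflectFst_mem_boxMinus (hup ν hν).2, (hup ν hν).2,
      isAttractingFixedPoint_of_fst_ne_zero (habs' ν hν) (hfix' ν hν) (hmem' ν hν) (hneg ν hν).ne,
      isAttractingFixedPoint_of_fst_ne_zero (habs' ν hν) (hfix ν hν) (hmem ν hν) (hpos ν hν).ne'⟩
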